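/- Let $K$ be a field, let $m,n,r$ be integers with $1\le r<\min\{m,n\}$, and let $X$ be an $m\times n$ matrix of indeterminates over $K$. Let $R_{r+1}=K[X]/I_{r+1}(X)$, where $I_{r+1}(X)$ is the ideal generated by all $(r+1)$-minors of $X$, with the standard grading in which every indeterminate has degree $1$. Let $\mathfrak p$ (resp. $\mathfrak q$) be the ideal of $R_{r+1}$ generated by the residue classes of the $r$-minors of the first $r$ rows (resp. the first $r$ columns) of $X$. Write $\mu(I)$ for the minimal number of generators of an ideal $I$, and $e(R_{r+1})$ for the multiplicity of $R_{r+1}$, i.e. $(\deg P)!$ times the leading coefficient of the Hilbert polynomial $P$ of $R_{r+1}$, where $P(k)=\dim_K (R_{r+1})_k$ for all $k\gg 0$. Then $$e(R_{r+1})=\mu(\mathfrak p^{\,m-r})=\mu(\mathfrak q^{\,n-r}).$$ -/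

import Mathlib

namespace Determinantal

/-- The set of `t`-minors of a matrix: determinants of `t × t` submatrices given by strictly
increasing row indices `a` and strictly increasing column indices `b`. It is empty when
`t` exceeds the number of rows or of columns. -/
def minors {A : Type*} [CommRing A] {m n : ℕ} (M : Matrix (Fin m) (Fin n) A) (t : ℕ) : Set A :=
  {d | ∃ (a : Fin t ↪o Fin m) (b : Fin t ↪o Fin n), d = (M.submatrix a b).det}

/-- The determinantal ideal `I_t(X)` of `K[X]`, generated by all `t`-minors of the `m × n` matrix
`X` of indeterminates (so it is `0` if `t > min m n`). -/
noncomputable def detIdeal (K : Type*) [Field K] (m n t : ℕ) : Ideal (MvPolynomial (Fin m × Fin n) K) :=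
  Ideal.span (minors (Matrix.mvPolynomialX (Fin m) (Fin n) K) t)

/-- The determinantal ring `R_{r+1} = K[X] / I_{r+1}(X)`. -/
abbrev DetRing (K : Type*) [Field K] (m n r : ℕ) : Type _ :=
  MvPolynomial (Fin m × Fin n) K ⧸ detIdeal K m n (r + 1)

/-- The matrix of the residue classes of the indeterminates in `R_{r+1}`. -/
noncomputable def genericMatrix (K : Type*) [Field K] (m n r : ℕ) :
    Matrix (Fin m) (Fin n) (DetRing K m n r) :=
  (Matrix.mvPolynomialX (Fin m) (Fin n) K).map (Ideal.Quotient.mk (detIdeal K m n (r + 1)))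

/-- The ideal `𝔭` of `R_{r+1}` generated by the `r`-minors of the first `r` rows. -/
noncomputable def rowIdeal (K : Type*) [Field K] (m n r : ℕ) (h : r ≤ m) : Ideal (DetRing K m n r) :=
  Ideal.span (minors ((genericMatrix K m n r).submatrix (Fin.castLE h) id) r)

/-- The ideal `𝔮` of `R_{r+1}` generated by the `r`-minors of the first `r` columns. -/
noncomputable def colIdeal (K : Type*) [Field K] (m n r : ℕ) (h : r ≤ n) : Ideal (DetRing K m n r) :=
  Ideal.span (minors ((genericMatrix K m n r).submatrix id (Fin.castLE h)) r)

/-- The standard grading of `R_{r+1}`: the degree `k` component consists of the residue classes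
of the homogeneous polynomials of degree `k`. -/
noncomputable def detRingGrading (K : Type*) [Field K] (m n r : ℕ) (k : ℕ) : Submodule K (DetRing K m n r) :=
  (MvPolynomial.homogeneousSubmodule (Fin m × Fin n) K k).map
    (Ideal.Quotient.mkₐ K (detIdeal K m n (r + 1))).toLinearMap

/-- `P` is the Hilbert polynomial of the `K`-algebra `A` with homogeneous components `𝒜 k`:
`P(k) = dim_K (𝒜 k)` for all large `k`. Such a `P` is unique if it exists. -/
def IsHilbertPolynomial {K A : Type*} [Field K] [CommRing A] [Algebra K A]
    (𝒜 : ℕ → Submodule K A) (P : Polynomial ℚ) : Prop :=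
  ∀ᶠ k : ℕ in Filter.atTop, (Module.finrank K (𝒜 k) : ℚ) = P.eval (k : ℚ)

/-- The homogeneous `K`-algebra `A` with homogeneous components `𝒜 k` has multiplicity `e`:
it has a Hilbert polynomial `P`, and `P` has leading coefficient `e / (deg P)!`; in the
case `P = 0` (dimension zero) the multiplicity is the length `dim_K A`. -/
def HasMultiplicity {K A : Type*} [Field K] [CommRing A] [Algebra K A]
    (𝒜 : ℕ → Submodule K A) (e : ℕ) : Prop :=
  ∃ P : Polynomial ℚ, IsHilbertPolynomial 𝒜 P ∧
    ((P ≠ 0 ∧ (e : ℚ) = (P.natDegree.factorial : ℚ) * P.leadingCoeff) ∨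
      (P = 0 ∧ e = Module.finrank K A))

end Determinantal

/-!
# The multiplicity of a determinantal ring

Both numbers count the same combinatorial objects: the semistandard tableaux of rectangular shape
with `r` rows, `m - r` columns and entries in `Fin n`.

*The Hilbert function of `R_{r+1}`.* Three numbers are compared in each degree `k`.
* Weighting the indeterminate `X_{ij}` by `i * j` makes the diagonal of each minor its heaviest term,
  so the monomials whose support contains no diagonal of length `r + 1` span
  `(R_{r+1})_k` (`detRingGrading_le_span`).
* The substitution `X ↦ Y * Z`, with `Y` of size `m × r` and `Z` of size `r × n`, kills the
  `(r + 1)`-minors. For a lexicographic order the leading monomial of the minor `[a | b]` of `Y * Z`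
  is `∏ y_{a s, s} z_{s, b s}` (`degree_det_submatrix_mul`), so that every pair of semistandard
  tableaux of the same shape with at most `r` rows occurs as the leading exponent of a product of
  minors (`exists_degree_prodMap`). The number of these pairs is thus a lower bound for
  `dim (R_{r+1})_k`.
* The Burge variant of the Robinson–Schensted–Knuth correspondence embeds the monomials without long
  diagonals into these pairs (`ncard_faceExponents_le`). It is built from a local rule, for which it
  is immediate that the number of rows of the tableaux is bounded by the length of the longest
  diagonal in the support.

Hence all these numbers agree (`finrank_detRingGrading`), and the leading exponents of the
forms in the entries of `Y * Z` are exactly the pairs of tableaux (`exists_tableauPair_of_degree`).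

*The multiplicity.* By the first point, `R_{r+1}` has the Hilbert function of the Stanley–Reisner
ring of the complex of sets of cells without a diagonal of length `r + 1`, so its multiplicity is
the number of faces of maximal size (`hasMultiplicity_detRing`). Such a face is a union of `r`
disjoint lattice paths; recording in which columns the paths go up gives a rectangular tableau
(`ncard_maxFaces`).

*The number of generators.* Setting the entries outside the first `r` rows to zero retracts
`R_{r+1}` onto a polynomial ring and reduces the question to the powers of the ideal of maximal
minors of a generic `r × n` matrix. The `k`-th power is generated in a single degree, by the
products of `k` maximal minors. After the substitution `X ↦ Y * Z` with a square matrix `Y`, these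
products become divisible by `det Y ^ k`, which forces the shape of the tableaux in their leading
exponents to be a rectangle; so there are as many generators as rectangular tableaux
(`finrank_minorProducts`). The columns are handled by transposition.
-/

namespace Determinantal

/-! ### Chains in a grid -/

/-- `HasChain S l i j` says that the relation `S`, seen as a set of cells, contains `l` cells
`(i₁, j₁), …, (iₗ, jₗ)` with `i₁ < ⋯ < iₗ < i` and `j₁ < ⋯ < jₗ < j`. -/
def HasChain (S : ℕ → ℕ → Prop) : ℕ → ℕ → ℕ → Prop
  | 0, _, _ => True
  | l + 1, i, j => ∃ i' < i, ∃ j' < j, S i' j' ∧ HasChain S l i' j'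

lemma HasChain.mono {S : ℕ → ℕ → Prop} {l i j i' j' : ℕ} (hi : i ≤ i') (hj : j ≤ j')
    (h : HasChain S l i j) : HasChain S l i' j' := by
  cases l with
  | zero => trivial
  | succ l =>
    obtain ⟨a, ha, b, hb, hS, h⟩ := h
    exact ⟨a, ha.trans_le hi, b, hb.trans_le hj, hS, h⟩

lemma HasChain.exists_strictMono {S : ℕ → ℕ → Prop} {l i j : ℕ} (h : HasChain S l i j) :
    ∃ a b : Fin l → ℕ, StrictMono a ∧ StrictMono b ∧
      ∀ s, a s < i ∧ b s < j ∧ S (a s) (b s) := by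
  induction l generalizing i j with
  | zero => exact ⟨fun _ => 0, fun _ => 0, fun s => s.elim0, fun s => s.elim0, fun s => s.elim0⟩
  | succ l ih =>
    obtain ⟨i', hi', j', hj', hS, h⟩ := h
    obtain ⟨a, b, ha, hb, hab⟩ := ih h
    refine ⟨Fin.snoc a i', Fin.snoc b j', ?_, ?_, ?_⟩
    · intro s t hst
      induction t using Fin.lastCases with
      | last =>
        obtain ⟨s, rfl⟩ := Fin.exists_castSucc_eq.2 hst.ne
        simpa using (hab s).1
      | cast t =>
        obtain ⟨s, rfl⟩ := Fin.exists_castSucc_eq.2 (hst.trans (Fin.castSucc_lt_last t)).ne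
        simpa using ha (by simpa using hst)
    · intro s t hst
      induction t using Fin.lastCases with
      | last =>
        obtain ⟨s, rfl⟩ := Fin.exists_castSucc_eq.2 hst.ne
        simpa using (hab s).2.1
      | cast t =>
        obtain ⟨s, rfl⟩ := Fin.exists_castSucc_eq.2 (hst.trans (Fin.castSucc_lt_last t)).ne
        simpa using hb (by simpa using hst)
    · intro s
      induction s using Fin.lastCases with
      | last => simpa using ⟨hi', hj', hS⟩
      | cast s =>
        simpa using ⟨(hab s).1.trans hi', (hab s).2.1.trans hj', (hab s).2.2⟩

/-- A set of cells of the `m × n` grid is a face if it contains no diagonal of an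
`(r + 1) × (r + 1)` submatrix. The faces form the simplicial complex whose Stanley–Reisner ideal
is generated by the diagonals of the `(r + 1)`-minors. -/
def IsFace {m n : ℕ} (r : ℕ) (F : Finset (Fin m × Fin n)) : Prop :=
  ∀ (a : Fin (r + 1) ↪o Fin m) (b : Fin (r + 1) ↪o Fin n), ∃ s, (a s, b s) ∉ F

lemma IsFace.not_hasChain {m n r : ℕ} {F : Finset (Fin m × Fin n)} (hF : IsFace r F) :
    ¬ HasChain (fun i j => ∃ (hi : i < m) (hj : j < n), ((⟨i, hi⟩, ⟨j, hj⟩) : Fin m × Fin n) ∈ F)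
      (r + 1) m n := by
  intro h
  obtain ⟨a, b, ha, hb, hab⟩ := h.exists_strictMono
  obtain ⟨s, hs⟩ := hF
    (OrderEmbedding.ofStrictMono (fun s => ⟨a s, (hab s).1⟩) fun s t hst => ha hst)
    (OrderEmbedding.ofStrictMono (fun s => ⟨b s, (hab s).2.1⟩) fun s t hst => hb hst)
  obtain ⟨_, _, h⟩ := (hab s).2.2
  exact hs h

/-! ### Semistandard exponents -/

/-- The partial sum `∑_{x < j} c x`. -/
def psum {n : ℕ} (c : Fin n → ℕ) (j : ℕ) : ℕ := ∑ x with x.val < j, c x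

lemma psum_zero {n : ℕ} (c : Fin n → ℕ) : psum c 0 = 0 := by simp [psum]

lemma psum_of_le {n : ℕ} (c : Fin n → ℕ) {j : ℕ} (h : n ≤ j) : psum c j = ∑ x, c x := by
  unfold psum
  congr 1
  ext x
  simpa using x.2.trans_le h

lemma psum_succ {n : ℕ} (c : Fin n → ℕ) (x : Fin n) : psum c (x + 1) = psum c x + c x := by
  unfold psum
  rw [add_comm _ (c x), ← Finset.sum_insert (by simp)]
  congr 1
  ext y
  simp only [Finset.mem_filter, Finset.mem_univ, true_and, Finset.mem_insert, Fin.ext_iff]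
  omega

lemma psum_mono {n : ℕ} (c : Fin n → ℕ) : Monotone (psum c) := by
  intro i j hij
  refine Finset.sum_le_sum_of_subset fun x => ?_
  simp only [Finset.mem_filter, Finset.mem_univ, true_and]
  omega

lemma psum_le {n : ℕ} (c : Fin n → ℕ) (j : ℕ) : psum c j ≤ ∑ x, c x :=
  Finset.sum_le_sum_of_subset (Finset.filter_subset _ _)

lemma psum_eq {n : ℕ} {c : Fin n → ℕ} {Q : ℕ → ℕ} (h0 : Q 0 = 0)
    (hQ : ∀ x : Fin n, Q x + c x = Q (x + 1)) {j : ℕ} (hj : j ≤ n) : psum c j = Q j := by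
  induction j with
  | zero => rw [psum_zero, h0]
  | succ j ih =>
    have := psum_succ c ⟨j, hj⟩
    have := hQ ⟨j, hj⟩
    have := ih (by omega)
    simp only at *
    omega

lemma psum_add {n : ℕ} (c d : Fin n → ℕ) (j : ℕ) : psum (c + d) j = psum c j + psum d j := by
  simp [psum, Finset.sum_add_distrib]

/-- `c s j` is read as the number of entries `j` in row `s` of a tableau with `r` rows and entries
in `Fin n`, every row being weakly increasing. `IsSemistandard c` says that the columns of this
tableau are strictly increasing: row `s'` has at most as many entries `≤ j` as an earlier row `s`
has entries `< j`. -/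
def IsSemistandard {r n : ℕ} (c : Fin r → Fin n → ℕ) : Prop :=
  ∀ s s' : Fin r, s < s' → ∀ j, psum (c s') (j + 1) ≤ psum (c s) j

lemma IsSemistandard.sum_le {r n : ℕ} {c : Fin r → Fin n → ℕ} (hc : IsSemistandard c)
    {s s' : Fin r} (h : s ≤ s') : ∑ j, c s' j ≤ ∑ j, c s j := by
  rcases h.eq_or_lt with rfl | h
  · rfl
  · simpa [psum_of_le] using hc s s' h n

/-! ### The local rule of the Burge correspondence -/

/-- The number of boxes available for the part with index `r - t` when the local rule is applied
with `κ` the old partition, `M` and `N` the pointwise maximum and minimum of the two neighbouring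
partitions, and `a` new boxes. The rule starts with the smallest part, fills each part as far as
interlacing permits, and passes the remaining boxes on to the next larger part. -/
def carry (r : ℕ) (κ M N : ℕ → ℕ) (a : ℕ) : ℕ → ℕ
  | 0 => a
  | t + 1 => (carry r κ M N a t + M (r - t) - κ (r - 1 - t)) + (N (r - 1 - t) - κ (r - 1 - t))

/-- The number of boxes available for part `s` in the local rule. -/
def carryAt (r : ℕ) (κ lam mu : ℕ → ℕ) (a s : ℕ) : ℕ := carry r κ (lam ⊔ mu) (lam ⊓ mu) a (r - s)

lemma carryAt_self (r : ℕ) (κ lam mu : ℕ → ℕ) (a : ℕ) : carryAt r κ lam mu a r = a := by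
  simp [carryAt, carry]

lemma carryAt_of_lt {r s : ℕ} (κ lam mu : ℕ → ℕ) (a : ℕ) (hs : s < r) :
    carryAt r κ lam mu a s =
      (carryAt r κ lam mu a (s + 1) + max (lam (s + 1)) (mu (s + 1)) - κ s) +
        (min (lam s) (mu s) - κ s) := by
  obtain ⟨t, rfl⟩ := Nat.exists_eq_add_of_lt hs
  have h1 : s + t + 1 - s = t + 1 := by omega
  have h2 : s + t + 1 - (s + 1) = t := by omega
  have h3 : s + t + 1 - t = s + 1 := by omega
  have h4 : s + t + 1 - 1 - t = s := by omega
  simp only [carryAt, h1, h2, carry, h3, h4, Pi.sup_apply, Pi.inf_apply]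

/-- The local rule of the Burge correspondence, truncated to partitions with at most `r` parts:
from partitions `κ ≺ lam`, `κ ≺ mu` and a number `a` it produces a partition `ν` with
`lam ≺ ν`, `mu ≺ ν`. -/
def burge (r : ℕ) (κ lam mu : ℕ → ℕ) (a s : ℕ) : ℕ :=
  if s < r then
    if s = 0 then max (lam 0) (mu 0) + carryAt r κ lam mu a 0
    else min (carryAt r κ lam mu a s + max (lam s) (mu s)) (κ (s - 1))
  else 0

/-- `lam` arises from `κ` by adding a horizontal strip: the two partitions interlace. -/
def Interlace (κ lam : ℕ → ℕ) : Prop := ∀ s, κ s ≤ lam s ∧ lam (s + 1) ≤ κ s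

lemma Interlace.antitone {κ lam : ℕ → ℕ} (h : Interlace κ lam) : Antitone lam :=
  antitone_nat_of_succ_le fun s => (h s).2.trans (h s).1

lemma Interlace.antitone_left {κ lam : ℕ → ℕ} (h : Interlace κ lam) : Antitone κ :=
  antitone_nat_of_succ_le fun s => (h (s + 1)).1.trans (h s).2

section burge
variable {r : ℕ} {κ lam mu : ℕ → ℕ} {a : ℕ}

lemma burge_of_le {s : ℕ} (hs : r ≤ s) : burge r κ lam mu a s = 0 := by
  simp [burge, hs]

lemma burge_zero (hr : 0 < r) :
    burge r κ lam mu a 0 = max (lam 0) (mu 0) + carryAt r κ lam mu a 0 := by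
  simp [burge, hr]

lemma burge_succ {s : ℕ} (hs : s + 1 < r) :
    burge r κ lam mu a (s + 1) =
      min (carryAt r κ lam mu a (s + 1) + max (lam (s + 1)) (mu (s + 1))) (κ s) := by
  simp [burge, hs]

lemma interlace_burge (h1 : Interlace κ lam) (h2 : Interlace κ mu)
    (hl : ∀ s, r ≤ s → lam s = 0) (hm : ∀ s, r ≤ s → mu s = 0) :
    Interlace lam (burge r κ lam mu a) ∧ Interlace mu (burge r κ lam mu a) := by
  have key : ∀ s, lam s ≤ burge r κ lam mu a s ∧ mu s ≤ burge r κ lam mu a s ∧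
      burge r κ lam mu a (s + 1) ≤ κ s := by
    intro s
    refine ⟨?_, ?_, ?_⟩
    · rcases lt_or_ge s r with hs | hs
      · cases s with
        | zero => rw [burge_zero hs]; omega
        | succ s => rw [burge_succ hs]; have := (h1 s).2; omega
      · simp [hl s hs]
    · rcases lt_or_ge s r with hs | hs
      · cases s with
        | zero => rw [burge_zero hs]; omega
        | succ s => rw [burge_succ hs]; have := (h2 s).2; omega
      · simp [hm s hs]
    · rcases lt_or_ge (s + 1) r with hs | hs
      · rw [burge_succ hs]; omega
      · simp [burge_of_le hs]
  exact ⟨fun s => ⟨(key s).1, (key s).2.2.trans (h1 s).1⟩,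
    fun s => ⟨(key s).2.1, (key s).2.2.trans (h2 s).1⟩⟩

lemma carryAt_le (h1 : Interlace κ lam) (h2 : Interlace κ mu) {s : ℕ} (hs : s ≤ r)
    (hl : lam s = 0) (hm : mu s = 0) : carryAt r κ lam mu a s ≤ a := by
  induction hs using Nat.decreasingInduction with
  | self => rw [carryAt_self]
  | of_succ s hs ih =>
    have e1 : lam (s + 1) ≤ lam s := h1.antitone (Nat.le_succ s)
    have e2 : mu (s + 1) ≤ mu s := h2.antitone (Nat.le_succ s)
    have := ih (by omega) (by omega)
    rw [carryAt_of_lt _ _ _ _ hs]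
    omega

/-- A new part can only be created by a new box, placed below a nonzero part of `κ`. -/
lemma pos_of_burge_pos (h1 : Interlace κ lam) (h2 : Interlace κ mu) {s : ℕ}
    (h : 0 < burge r κ lam mu a s) :
    0 < lam s ∨ 0 < mu s ∨ (0 < a ∧ (s = 0 ∨ 0 < κ (s - 1))) := by
  have hs : s < r := by
    by_contra hs
    rw [burge_of_le (not_lt.1 hs)] at h
    omega
  by_contra hcon
  have hl : lam s = 0 := by omega
  have hm : mu s = 0 := by omega
  have hc := carryAt_le (r := r) (a := a) h1 h2 hs.le hl hm
  cases s with
  | zero => rw [burge_zero hs] at h; omega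
  | succ s =>
    rw [burge_succ hs] at h
    have : s + 1 - 1 = s := rfl
    rw [this] at hcon
    omega

/-- The local rule preserves the number of boxes, as long as no part beyond the `r`-th is
needed. -/
lemma sum_burge (hr : 0 < r) (h1 : Interlace κ lam) (h2 : Interlace κ mu)
    (hl : lam r = 0) (hm : mu r = 0) (ha : a = 0 ∨ κ (r - 1) = 0) :
    ∑ s ∈ Finset.range r, burge r κ lam mu a s + ∑ s ∈ Finset.range r, κ s =
      ∑ s ∈ Finset.range r, lam s + ∑ s ∈ Finset.range r, mu s + a := by
  have hsum : ∀ t, ∑ s ∈ Finset.range t, lam s + ∑ s ∈ Finset.range t, mu s =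
      ∑ s ∈ Finset.range t, max (lam s) (mu s) + ∑ s ∈ Finset.range t, min (lam s) (mu s) := by
    intro t
    rw [← Finset.sum_add_distrib, ← Finset.sum_add_distrib]
    exact Finset.sum_congr rfl fun s _ => (max_add_min _ _).symm
  have key : ∀ s, s < r →
      ∑ i ∈ Finset.range (s + 1), burge r κ lam mu a i + ∑ i ∈ Finset.range s, κ i =
        ∑ i ∈ Finset.range (s + 1), max (lam i) (mu i) +
          ∑ i ∈ Finset.range s, min (lam i) (mu i) + carryAt r κ lam mu a s := by
    intro s
    induction s with
    | zero => intro hs; simp [burge_zero hs]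
    | succ s ih =>
      intro hs
      have ih := ih (by omega)
      have := burge_succ (κ := κ) (lam := lam) (mu := mu) (a := a) hs
      have := carryAt_of_lt κ lam mu a (show s < r by omega)
      have := (h1 s).1
      have := (h2 s).1
      rw [Finset.sum_range_succ (burge r κ lam mu a) (s + 1), Finset.sum_range_succ κ s,
        Finset.sum_range_succ (fun i => max (lam i) (mu i)) (s + 1),
        Finset.sum_range_succ (fun i => min (lam i) (mu i)) s]
      omega
  obtain ⟨t, rfl⟩ : ∃ t, r = t + 1 := ⟨r - 1, by omega⟩
  have k := key t (by omega)
  have := carryAt_of_lt κ lam mu a (show t < t + 1 by omega)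
  rw [carryAt_self, hl, hm] at this
  have := (h1 t).1
  have := (h2 t).1
  rw [hsum, Finset.sum_range_succ κ, Finset.sum_range_succ (fun i => min (lam i) (mu i))]
  simp only [Nat.add_sub_cancel] at ha
  omega

/-- The local rule is injective in `κ` and `a`, as long as no part beyond the `r`-th is needed. -/
lemma burge_injective {κ' : ℕ → ℕ} {a' : ℕ} (hr : 0 < r) (h1 : Interlace κ lam)
    (h2 : Interlace κ mu) (h1' : Interlace κ' lam) (h2' : Interlace κ' mu)
    (hl : ∀ s, r ≤ s → lam s = 0) (hm : ∀ s, r ≤ s → mu s = 0)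
    (ha : a = 0 ∨ κ (r - 1) = 0) (ha' : a' = 0 ∨ κ' (r - 1) = 0)
    (h : burge r κ lam mu a = burge r κ' lam mu a') : κ = κ' ∧ a = a' := by
  have step : ∀ s, s + 1 < r → carryAt r κ lam mu a s = carryAt r κ' lam mu a' s →
      κ s = κ' s ∧ carryAt r κ lam mu a (s + 1) = carryAt r κ' lam mu a' (s + 1) := by
    intro s hs hc
    have e := congrFun h (s + 1)
    rw [burge_succ hs, burge_succ hs] at e
    rw [carryAt_of_lt κ lam mu a (show s < r by omega),
      carryAt_of_lt κ' lam mu a' (show s < r by omega)] at hc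
    have := (h1 s).1
    have := (h2 s).1
    have := (h1' s).1
    have := (h2' s).1
    omega
  have hc : ∀ s, s < r → carryAt r κ lam mu a s = carryAt r κ' lam mu a' s := by
    intro s
    induction s with
    | zero =>
      intro hs
      have e := congrFun h 0
      rw [burge_zero hs, burge_zero hs] at e
      omega
    | succ s ih => exact fun hs => (step s hs (ih (by omega))).2
  obtain ⟨t, rfl⟩ : ∃ t, r = t + 1 := ⟨r - 1, by omega⟩
  have top : κ t = κ' t ∧ a = a' := by
    have e := hc t (by omega)
    rw [carryAt_of_lt κ lam mu a (Nat.lt_succ_self t),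
      carryAt_of_lt κ' lam mu a' (Nat.lt_succ_self t), carryAt_self,
      carryAt_self, hl _ le_rfl, hm _ le_rfl] at e
    have := (h1 t).1
    have := (h2 t).1
    have := (h1' t).1
    have := (h2' t).1
    simp only [Nat.add_sub_cancel] at ha ha'
    omega
  refine ⟨funext fun s => ?_, top.2⟩
  rcases lt_trichotomy s t with hs | rfl | hs
  · exact (step s (by omega) (hc s (by omega))).1
  · exact top.1
  · have := (h1 s).1
    have := (h1' s).1
    have := hl s hs
    omega

end burge

/-! ### The Burge correspondence -/

/-- One row of the growth diagram, computed from the previous row `prev` and the entries `a` of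
the matrix in this row. -/
def growthRow (r : ℕ) (prev : ℕ → ℕ → ℕ) (a : ℕ → ℕ) : ℕ → ℕ → ℕ
  | 0 => fun _ => 0
  | j + 1 => burge r (prev j) (prev (j + 1)) (growthRow r prev a j) (a j)

/-- The growth diagram of a matrix `A` under the local rule `burge`: `growth r A i j` is the
partition attached to the first `i` rows and `j` columns of `A`. -/
def growth (r : ℕ) (A : ℕ → ℕ → ℕ) : ℕ → ℕ → ℕ → ℕ
  | 0 => fun _ _ => 0
  | i + 1 => growthRow r (growth r A i) (A i)

section growth
variable {r : ℕ} {A : ℕ → ℕ → ℕ}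

lemma growth_zero_left (j s : ℕ) : growth r A 0 j s = 0 := rfl

lemma growth_zero_right (i s : ℕ) : growth r A i 0 s = 0 := by
  cases i <;> rfl

lemma growth_succ_succ (i j : ℕ) : growth r A (i + 1) (j + 1) =
    burge r (growth r A i j) (growth r A i (j + 1)) (growth r A (i + 1) j) (A i j) := rfl

lemma growth_of_le (i j : ℕ) {s : ℕ} (hs : r ≤ s) : growth r A i j s = 0 := by
  cases i with
  | zero => rfl
  | succ i =>
    cases j with
    | zero => rfl
    | succ j => rw [growth_succ_succ, burge_of_le hs]

lemma interlace_growth (i : ℕ) : (∀ j, Interlace (growth r A i j) (growth r A i (j + 1))) ∧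
    ∀ j, Interlace (growth r A i j) (growth r A (i + 1) j) := by
  have vert : ∀ i, (∀ j, Interlace (growth r A i j) (growth r A i (j + 1))) →
      ∀ j, Interlace (growth r A i j) (growth r A (i + 1) j) := by
    intro i hi j
    induction j with
    | zero => intro s; simp [growth_zero_right]
    | succ j ih =>
      exact (interlace_burge (hi j) ih (fun s => growth_of_le _ _) fun s => growth_of_le _ _).1
  have hor : ∀ j, Interlace (growth r A i j) (growth r A i (j + 1)) := by
    induction i with
    | zero => intro j s; simp [growth_zero_left]
    | succ i ih =>
      intro j
      exact (interlace_burge (ih j) (vert i ih j) (fun s => growth_of_le _ _)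
        fun s => growth_of_le _ _).2
  exact ⟨hor, vert i hor⟩

/-- The number of parts of the partition attached to a box is at most the length of the longest
chain in the support of the matrix inside this box. -/
lemma hasChain_of_growth_pos (i j : ℕ) {s : ℕ} (h : 0 < growth r A i j s) :
    HasChain (fun i j => A i j ≠ 0) (s + 1) i j := by
  induction i generalizing j s with
  | zero => simp [growth_zero_left] at h
  | succ i ihi =>
    induction j generalizing s with
    | zero => simp [growth_zero_right] at h
    | succ j ihj =>
      rw [growth_succ_succ] at h
      rcases pos_of_burge_pos ((interlace_growth i).1 j) ((interlace_growth i).2 j) h with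
        h | h | ⟨ha, h⟩
      · exact (ihi _ h).mono (Nat.le_succ _) le_rfl
      · exact (ihj h).mono le_rfl (Nat.le_succ _)
      · refine ⟨i, Nat.lt_succ_self _, j, Nat.lt_succ_self _, ha.ne', ?_⟩
        cases s with
        | zero => trivial
        | succ s => exact ihi _ (h.resolve_left (Nat.succ_ne_zero _))

variable {m n : ℕ}

/-- If the support contains no chain of length `r + 1`, the local rule never needs a part beyond the
`r`-th. -/
lemma growth_eq_zero_of_chainless (hr : 0 < r)
    (hA : ¬ HasChain (fun i j => A i j ≠ 0) (r + 1) m n) {i j : ℕ} (hi : i < m) (hj : j < n) :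
    A i j = 0 ∨ growth r A i j (r - 1) = 0 := by
  by_contra! hcon
  have h := hasChain_of_growth_pos i j (Nat.pos_of_ne_zero hcon.2)
  rw [Nat.sub_add_cancel hr] at h
  exact hA ⟨i, hi, j, hj, hcon.1, h⟩

lemma sum_growth (hr : 0 < r) (hA : ¬ HasChain (fun i j => A i j ≠ 0) (r + 1) m n)
    {i j : ℕ} (hi : i ≤ m) (hj : j ≤ n) :
    ∑ s ∈ Finset.range r, growth r A i j s =
      ∑ x ∈ Finset.range i, ∑ y ∈ Finset.range j, A x y := by
  induction i generalizing j with
  | zero => simp [growth_zero_left]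
  | succ i ihi =>
    induction j with
    | zero => simp [growth_zero_right]
    | succ j ihj =>
      have h := sum_burge hr ((interlace_growth (r := r) (A := A) i).1 j)
        ((interlace_growth i).2 j) (growth_of_le _ _ le_rfl) (growth_of_le _ _ le_rfl)
        (growth_eq_zero_of_chainless hr hA hi hj)
      rw [← growth_succ_succ, ihi (by omega) (by omega), ihi (by omega) hj, ihj (by omega)] at h
      rw [Finset.sum_range_succ] at h ⊢
      rw [Finset.sum_range_succ (A i) j]
      omega

lemma growth_injective {A' : ℕ → ℕ → ℕ} (hr : 0 < r)
    (hA : ¬ HasChain (fun i j => A i j ≠ 0) (r + 1) m n)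
    (hA' : ¬ HasChain (fun i j => A' i j ≠ 0) (r + 1) m n)
    (hrow : ∀ j ≤ n, growth r A m j = growth r A' m j)
    (hcol : ∀ i ≤ m, growth r A i n = growth r A' i n) {i j : ℕ} (hi : i < m) (hj : j < n) :
    A i j = A' i j := by
  have step : ∀ i j, i < m → j < n → growth r A i (j + 1) = growth r A' i (j + 1) →
      growth r A (i + 1) j = growth r A' (i + 1) j →
      growth r A (i + 1) (j + 1) = growth r A' (i + 1) (j + 1) →
      growth r A i j = growth r A' i j ∧ A i j = A' i j := by
    intro i j hi hj h1 h2 h3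
    rw [growth_succ_succ, growth_succ_succ, ← h1, ← h2] at h3
    have k1 := (interlace_growth (r := r) (A := A') i).1 j
    have k2 := (interlace_growth (r := r) (A := A') i).2 j
    rw [← h1] at k1
    rw [← h2] at k2
    exact burge_injective hr ((interlace_growth i).1 j) ((interlace_growth i).2 j) k1 k2
      (fun s => growth_of_le _ _) (fun s => growth_of_le _ _)
      (growth_eq_zero_of_chainless hr hA hi hj) (growth_eq_zero_of_chainless hr hA' hi hj) h3
  have all : ∀ i, i ≤ m → ∀ j, j ≤ n → growth r A i j = growth r A' i j := by
    intro i hi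
    induction hi using Nat.decreasingInduction with
    | self => exact hrow
    | of_succ i hi ih =>
      intro j hj
      induction hj using Nat.decreasingInduction with
      | self => exact hcol i (le_of_lt hi)
      | of_succ j hj ihj =>
        exact (step i j hi hj ihj (ih j hj.le) (ih (j + 1) hj)).1
  exact (step i j hi hj (all i hi.le (j + 1) hj) (all (i + 1) hi j hj.le)
    (all (i + 1) hi (j + 1) hj)).2

end growth

/-- A matrix indexed by `Fin m × Fin n`, extended by zero to `ℕ × ℕ`. -/
def extendZero {m n : ℕ} (e : Fin m × Fin n → ℕ) (i j : ℕ) : ℕ :=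
  if h : i < m ∧ j < n then e (⟨i, h.1⟩, ⟨j, h.2⟩) else 0

lemma extendZero_apply {m n : ℕ} (e : Fin m × Fin n → ℕ) (x : Fin m) (y : Fin n) :
    extendZero e x y = e (x, y) := by
  simp [extendZero]

/-- The left tableau of the Burge correspondence. -/
def burgeLeft {m n : ℕ} (r : ℕ) (e : Fin m × Fin n → ℕ) (s : Fin r) (x : Fin m) : ℕ :=
  growth r (extendZero e) (x + 1) n s - growth r (extendZero e) x n s

/-- The right tableau of the Burge correspondence. -/
def burgeRight {m n : ℕ} (r : ℕ) (e : Fin m × Fin n → ℕ) (s : Fin r) (y : Fin n) : ℕ :=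
  growth r (extendZero e) m (y + 1) s - growth r (extendZero e) m y s

section correspondence
variable {r m n : ℕ} (e : Fin m × Fin n → ℕ)

lemma psum_burgeLeft (s : Fin r) {i : ℕ} (hi : i ≤ m) :
    psum (burgeLeft r e s) i = growth r (extendZero e) i n s :=
  psum_eq (Q := fun i => growth r (extendZero e) i n s) (growth_zero_left _ _)
    (fun x => Nat.add_sub_cancel' (((interlace_growth x).2 n) s).1) hi

lemma psum_burgeRight (s : Fin r) {j : ℕ} (hj : j ≤ n) :
    psum (burgeRight r e s) j = growth r (extendZero e) m j s :=
  psum_eq (Q := fun j => growth r (extendZero e) m j s) (growth_zero_right _ _)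
    (fun x => Nat.add_sub_cancel' (((interlace_growth m).1 x) s).1) hj

lemma sum_burgeLeft (s : Fin r) :
    ∑ x, burgeLeft r e s x = growth r (extendZero e) m n s := by
  rw [← psum_of_le _ le_rfl, psum_burgeLeft e s le_rfl]

lemma sum_burgeRight (s : Fin r) :
    ∑ y, burgeRight r e s y = growth r (extendZero e) m n s := by
  rw [← psum_of_le _ le_rfl, psum_burgeRight e s le_rfl]

lemma isSemistandard_of_interlace {c : Fin r → Fin n → ℕ} {G : ℕ → ℕ → ℕ}
    (hG : ∀ j, Interlace (G j) (G (j + 1))) (hc : ∀ s, ∀ j ≤ n, psum (c s) j = G j s) :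
    IsSemistandard c := by
  intro s s' hs j
  rcases lt_or_ge j n with hj | hj
  · rw [hc _ _ hj, hc _ _ hj.le]
    exact ((hG j).antitone (show (s : ℕ) + 1 ≤ s' from hs)).trans ((hG j) s).2
  · rw [psum_of_le _ hj, psum_of_le _ (by omega), ← psum_of_le _ le_rfl, ← psum_of_le _ le_rfl,
      hc _ _ le_rfl, hc _ _ le_rfl]
    exact (hG n).antitone_left (le_of_lt hs)

lemma isSemistandard_burgeLeft : IsSemistandard (burgeLeft r e) :=
  isSemistandard_of_interlace (G := fun i => growth r (extendZero e) i n)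
    (fun i => (interlace_growth i).2 n) fun s _ hj => psum_burgeLeft e s hj

lemma isSemistandard_burgeRight : IsSemistandard (burgeRight r e) :=
  isSemistandard_of_interlace (G := fun j => growth r (extendZero e) m j)
    (fun j => (interlace_growth m).1 j) fun s _ hj => psum_burgeRight e s hj

variable {e}

lemma not_hasChain_extendZero {F : Finset (Fin m × Fin n)} (hF : IsFace r F)
    (he : ∀ x, e x ≠ 0 → x ∈ F) :
    ¬ HasChain (fun i j => extendZero e i j ≠ 0) (r + 1) m n := by
  have himp : ∀ l i j, HasChain (fun i j => extendZero e i j ≠ 0) l i j →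
      HasChain (fun i j => ∃ (hi : i < m) (hj : j < n),
        ((⟨i, hi⟩, ⟨j, hj⟩) : Fin m × Fin n) ∈ F) l i j := by
    intro l
    induction l with
    | zero => exact fun _ _ _ => trivial
    | succ l ih =>
      rintro i j ⟨i', hi', j', hj', h, hc⟩
      refine ⟨i', hi', j', hj', ?_, ih _ _ hc⟩
      unfold extendZero at h
      split_ifs at h with hij
      · exact ⟨hij.1, hij.2, he _ h⟩
      · exact absurd rfl h
  exact fun h => hF.not_hasChain (himp _ _ _ h)

lemma sum_sum_burgeLeft (hr : 0 < r)
    (he : ¬ HasChain (fun i j => extendZero e i j ≠ 0) (r + 1) m n) :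
    ∑ s, ∑ x, burgeLeft r e s x = ∑ x, e x := by
  simp_rw [sum_burgeLeft]
  rw [Fin.sum_univ_eq_sum_range (fun s => growth r (extendZero e) m n s),
    sum_growth hr he le_rfl le_rfl, Fintype.sum_prod_type, Finset.sum_range]
  refine Finset.sum_congr rfl fun x _ => ?_
  rw [Finset.sum_range]
  exact Finset.sum_congr rfl fun y _ => extendZero_apply e x y

lemma burge_correspondence_injective {e' : Fin m × Fin n → ℕ} (hr : 0 < r)
    (he : ¬ HasChain (fun i j => extendZero e i j ≠ 0) (r + 1) m n)
    (he' : ¬ HasChain (fun i j => extendZero e' i j ≠ 0) (r + 1) m n)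
    (hl : burgeLeft r e = burgeLeft r e') (hR : burgeRight r e = burgeRight r e') : e = e' := by
  funext ⟨x, y⟩
  rw [← extendZero_apply e, ← extendZero_apply e']
  refine growth_injective hr he he' (fun j hj => funext fun s => ?_)
    (fun i hi => funext fun s => ?_) x.2 y.2
  · rcases lt_or_ge s r with hs | hs
    · rw [← psum_burgeRight e ⟨s, hs⟩ hj, hR, psum_burgeRight e' ⟨s, hs⟩ hj]
    · rw [growth_of_le _ _ hs, growth_of_le _ _ hs]
  · rcases lt_or_ge s r with hs | hs
    · rw [← psum_burgeLeft e ⟨s, hs⟩ hi, hl, psum_burgeLeft e' ⟨s, hs⟩ hi]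
    · rw [growth_of_le _ _ hs, growth_of_le _ _ hs]

end correspondence

/-! ### Faces of maximal size -/

section levels
variable {m n : ℕ}

/-- The level of the cell `(i, j)` with respect to a set `F` of cells: the largest value of
`max (i₀ - h) 0 + l` over all chains `(i₀, j₀) < ⋯ < (iₗ, jₗ) = (i, j)` whose cells other than
`(i, j)` lie in `F`. The summand `i₀ - h` makes the level sets of a face of maximal size into
lattice paths which all start in the first column. -/
def level (h : ℕ) (F : Finset (Fin m × Fin n)) (i j : ℕ) : ℕ :=
  max (i - h) ((F.filter fun x => x.1.val < i ∧ x.2.val < j).attach.sup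
    fun x => level h F x.1.1 x.1.2 + 1)
termination_by i
decreasing_by exact (Finset.mem_filter.1 x.2).2.1

variable {h : ℕ} {F : Finset (Fin m × Fin n)}

lemma sub_le_level (i j : ℕ) : i - h ≤ level h F i j := by
  rw [level]
  exact le_max_left _ _

lemma level_lt {x : Fin m × Fin n} (hx : x ∈ F) {i j : ℕ} (hi : x.1.val < i) (hj : x.2.val < j) :
    level h F x.1 x.2 < level h F i j := by
  rw [level.eq_1 h F i j, lt_max_iff, ← Nat.add_one_le_iff, ← Nat.add_one_le_iff]
  exact Or.inr (Finset.le_sup (f := fun x : {x // x ∈ F.filter fun x => x.1.val < i ∧ x.2.val < j} =>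
    level h F x.1.1 x.1.2 + 1) (Finset.mem_attach _ ⟨x, Finset.mem_filter.2 ⟨hx, hi, hj⟩⟩))

lemma level_cases (i j : ℕ) : level h F i j = i - h ∨
    ∃ x ∈ F, x.1.val < i ∧ x.2.val < j ∧ level h F i j = level h F x.1 x.2 + 1 := by
  rw [level.eq_1 h F i j]
  rcases (F.filter fun x => x.1.val < i ∧ x.2.val < j).attach.eq_empty_or_nonempty with he | hne
  · left
    rw [he]
    simp
  · obtain ⟨x, -, hx⟩ := Finset.exists_mem_eq_sup _ hne fun x => level h F x.1.1 x.1.2 + 1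
    rw [hx]
    rcases max_choice (i - h) (level h F x.1.1 x.1.2 + 1) with h' | h' <;> rw [h']
    · exact Or.inl rfl
    · obtain ⟨h1, h2⟩ := Finset.mem_filter.1 x.2
      exact Or.inr ⟨x.1, h1, h2.1, h2.2, rfl⟩

lemma level_mono {i i' : ℕ} (hi : i ≤ i') (j : ℕ) : level h F i j ≤ level h F i' j := by
  rcases level_cases (h := h) (F := F) i j with h' | ⟨x, hx, h1, h2, h'⟩
  · rw [h']
    exact le_trans (by omega) (sub_le_level i' j)
  · rw [h']
    exact level_lt hx (h1.trans_le hi) h2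

lemma level_le (i j : ℕ) : level h F i j ≤ i := by
  induction i using Nat.strong_induction_on generalizing j with
  | _ i ih =>
    rcases level_cases (h := h) (F := F) i j with h' | ⟨x, -, h1, -, h'⟩
    · omega
    · have := ih _ h1 x.2
      omega

lemma level_le_sub_or_hasChain (i j : ℕ) : level h F i j ≤ i - h ∨
    HasChain (fun i j => ∃ (hi : i < m) (hj : j < n), ((⟨i, hi⟩, ⟨j, hj⟩) : Fin m × Fin n) ∈ F)
      (level h F i j) i j := by
  induction i using Nat.strong_induction_on generalizing j with
  | _ i ih =>
    rcases level_cases (h := h) (F := F) i j with h' | ⟨x, hx, h1, h2, h'⟩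
    · exact Or.inl h'.le
    · rcases ih _ h1 x.2 with h3 | h3
      · rcases Nat.eq_zero_or_pos (level h F x.1 x.2) with h0 | h0
        · right
          rw [h', h0]
          exact ⟨x.1, h1, x.2, h2, ⟨x.1.2, x.2.2, hx⟩, trivial⟩
        · left
          omega
      · right
        rw [h']
        exact ⟨x.1, h1, x.2, h2, ⟨x.1.2, x.2.2, hx⟩, h3⟩

lemma level_lt_of_isFace {r : ℕ} (hr : 0 < r) (hm : m = h + r) (hF : IsFace r F)
    {x : Fin m × Fin n} (hx : x ∈ F) : level h F x.1 x.2 < r := by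
  rcases level_le_sub_or_hasChain (h := h) (F := F) x.1 x.2 with h' | h'
  · have := x.1.2
    omega
  · by_contra! hcon
    have hc : HasChain (fun i j => ∃ (hi : i < m) (hj : j < n),
        ((⟨i, hi⟩, ⟨j, hj⟩) : Fin m × Fin n) ∈ F) (level h F x.1 x.2 + 1) m n :=
      ⟨x.1, x.1.2, x.2, x.2.2, ⟨x.1.2, x.2.2, hx⟩, h'⟩
    obtain ⟨a, b, ha, hb, hab⟩ := hc.exists_strictMono
    have hle : r + 1 ≤ level h F x.1 x.2 + 1 := by omega
    obtain ⟨s, hs⟩ := hF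
      (OrderEmbedding.ofStrictMono (fun s => ⟨a (s.castLE hle), (hab _).1⟩) fun s t hst => ha hst)
      (OrderEmbedding.ofStrictMono (fun s => ⟨b (s.castLE hle), (hab _).2.1⟩) fun s t hst => hb hst)
    obtain ⟨_, _, h⟩ := (hab (s.castLE hle)).2.2
    exact hs h

/-- The number of up-steps, in the columns before the column `j`, of the lattice path through the
cells of level `s`. -/
def upSteps (h : ℕ) (F : Finset (Fin m × Fin n)) (s j : ℕ) : ℕ :=
  (F.filter fun x => level h F x.1 x.2 = s ∧ x.2.val < j).sup fun x => h + s - x.1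

lemma upSteps_zero (s : ℕ) : upSteps h F s 0 = 0 := by simp [upSteps]

lemma upSteps_mono (s : ℕ) : Monotone (upSteps h F s) := by
  intro i j hij
  refine Finset.sup_mono fun x hx => ?_
  simp only [Finset.mem_filter] at hx ⊢
  exact ⟨hx.1, hx.2.1, hx.2.2.trans_le hij⟩

lemma upSteps_le (s j : ℕ) : upSteps h F s j ≤ h := by
  refine Finset.sup_le fun x hx => ?_
  have := level_le (h := h) (F := F) x.1 x.2
  have := (Finset.mem_filter.1 hx).2.1
  omega

end levels

section paths
variable {m n : ℕ}

/-- The lattice path from the cell `(h + s, 0)` to the right border which makes `c j` up-steps in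
column `j`. -/
def pathSet (h s : ℕ) (c : Fin n → ℕ) : Finset (Fin m × Fin n) :=
  Finset.univ.filter fun x =>
    h + s ≤ x.1 + psum c (x.2 + 1) ∧ x.1 + psum c x.2 ≤ h + s

/-- The union of the lattice paths given by the rows of a tableau. -/
def pathFamily {r : ℕ} (h : ℕ) (q : Fin r → Fin n → ℕ) : Finset (Fin m × Fin n) :=
  Finset.univ.biUnion fun s : Fin r => pathSet h s (q s)

lemma mem_pathSet {h s : ℕ} {c : Fin n → ℕ} {x : Fin m × Fin n} : x ∈ pathSet h s c ↔
    h + s ≤ x.1 + psum c (x.2 + 1) ∧ x.1 + psum c x.2 ≤ h + s := by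
  simp [pathSet]

lemma mem_pathFamily {r h : ℕ} {q : Fin r → Fin n → ℕ} {x : Fin m × Fin n} :
    x ∈ pathFamily h q ↔ ∃ s : Fin r,
      h + s ≤ x.1 + psum (q s) (x.2 + 1) ∧ x.1 + psum (q s) x.2 ≤ h + s := by
  simp [pathFamily, mem_pathSet]

lemma card_pathSet {h s : ℕ} {c : Fin n → ℕ} (hs : h + s < m) (hc : ∑ j, c j ≤ h) :
    (pathSet h s c : Finset (Fin m × Fin n)).card = n + ∑ j, c j := by
  rw [Finset.card_eq_sum_card_fiberwise (f := Prod.snd) (t := Finset.univ) (by simp)]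
  have : ∀ j : Fin n, ((pathSet h s c : Finset (Fin m × Fin n)).filter fun x => x.2 = j).card =
      1 + c j := by
    intro j
    have h1 := psum_le c (j + 1)
    have h2 := psum_succ c j
    have hcard : (Finset.Icc (h + s - psum c (j + 1)) (h + s - psum c j)).card = 1 + c j := by
      rw [Nat.card_Icc]
      omega
    rw [← hcard]
    refine Finset.card_bij (fun x _ => x.1.val) ?_ ?_ ?_
    · intro x hx
      rw [Finset.mem_filter] at hx
      obtain ⟨hxp, rfl⟩ := hx
      have := mem_pathSet.1 hxp
      simp only [Finset.mem_Icc]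
      omega
    · intro x hx y hy hxy
      exact Prod.ext (Fin.ext hxy)
        ((Finset.mem_filter.1 hx).2.trans (Finset.mem_filter.1 hy).2.symm)
    · intro i hi
      rw [Finset.mem_Icc] at hi
      refine ⟨(⟨i, by omega⟩, j), ?_, rfl⟩
      simp only [Finset.mem_filter, mem_pathSet, and_true]
      omega
  rw [Finset.sum_congr rfl fun j _ => this j, Finset.sum_add_distrib]
  simp

variable {r h : ℕ}

/-- The semistandard tableaux of rectangular shape with `r` rows, `h` columns and entries in
`Fin n`. -/
def rectTableaux (r n h : ℕ) : Set (Fin r → Fin n → ℕ) :=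
  {q | IsSemistandard q ∧ ∀ s, ∑ j, q s j = h}

/-- The faces with `r * (n + h)` cells; for `m = h + r` this is the maximal number of cells. -/
def maxFaces (m n r h : ℕ) : Set (Finset (Fin m × Fin n)) :=
  {F | IsFace r F ∧ F.card = r * (n + h)}

lemma isFace_pathFamily (q : Fin r → Fin n → ℕ) :
    IsFace r (pathFamily h q : Finset (Fin m × Fin n)) := by
  intro a b
  by_contra! hcon
  simp only [mem_pathFamily] at hcon
  choose f hf using hcon
  obtain ⟨s, t, hst, hfst⟩ := Fintype.exists_ne_map_eq_of_card_lt f (by simp)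
  wlog hlt : s < t generalizing s t
  · exact this t s hst.symm hfst.symm (lt_of_le_of_ne (not_lt.1 hlt) hst.symm)
  have h1 := (hf s).1
  have h2 := (hf t).2
  rw [← hfst] at h2
  have ha : (a s).val < a t := a.strictMono hlt
  have hb : (b s).val < b t := b.strictMono hlt
  have := psum_mono (q (f s)) (show (b s).val + 1 ≤ b t from hb)
  omega

lemma card_pathFamily (hm : m = h + r) {q : Fin r → Fin n → ℕ} (hq : q ∈ rectTableaux r n h) :
    (pathFamily h q : Finset (Fin m × Fin n)).card = r * (n + h) := by
  have key : ∀ s s' : Fin r, s < s' →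
      Disjoint (pathSet h s (q s) : Finset (Fin m × Fin n)) (pathSet h s' (q s')) := by
    intro s s' hs
    rw [Finset.disjoint_left]
    intro x hx hx'
    have h1 := mem_pathSet.1 hx
    have h2 := mem_pathSet.1 hx'
    have h3 := hq.1 s s' hs x.2
    have : s.val < s' := hs
    omega
  rw [pathFamily, Finset.card_biUnion]
  · rw [Finset.sum_congr rfl fun s _ => card_pathSet (by have := s.2; omega) (hq.2 s).le]
    simp [hq.2]
  · intro s _ s' _ hs
    rcases lt_or_gt_of_ne hs with hs | hs
    · exact key s s' hs
    · exact (key s' s hs).symm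

lemma pathFamily_injOn (hm : m = h + r) :
    Set.InjOn (fun q => (pathFamily h q : Finset (Fin m × Fin n))) (rectTableaux r n h) := by
  have le_of : ∀ q ∈ rectTableaux r n h, ∀ q' ∈ rectTableaux r n h,
      (pathFamily h q : Finset (Fin m × Fin n)) = pathFamily h q' → ∀ j : Fin n,
      (∀ s, psum (q s) j = psum (q' s) j) → ∀ s, psum (q' s) (j + 1) ≤ psum (q s) (j + 1) := by
    intro q hq q' hq' he j hj s
    by_contra! hlt
    have hs := s.2
    have hle := psum_le (q' s) (j + 1)
    rw [hq'.2] at hle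
    -- the topmost cell in column `j` of the path `s` of `q'`
    have hmem : ((⟨h + s - psum (q' s) (j + 1), by omega⟩, j) : Fin m × Fin n) ∈
        pathFamily h q' := by
      rw [mem_pathFamily]
      refine ⟨s, ?_, ?_⟩
      · simp only
        omega
      · have := psum_mono (q' s) (Nat.le_succ j)
        simp only [Nat.succ_eq_add_one] at *
        omega
    rw [← he, mem_pathFamily] at hmem
    obtain ⟨t, h1, h2⟩ := hmem
    simp only at h1 h2
    rcases lt_trichotomy t s with hts | rfl | hts
    · have h3 := hq'.1 t s hts j
      rw [← hj t] at h3
      have : t.val < s := hts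
      omega
    · omega
    · have h3 := hq.1 s t hts j
      have h4 := psum_mono (q s) (Nat.le_succ j)
      have : s.val < t := hts
      simp only [Nat.succ_eq_add_one] at *
      omega
  intro q hq q' hq' he
  have all : ∀ j ≤ n, ∀ s, psum (q s) j = psum (q' s) j := by
    intro j
    induction j with
    | zero => intro _ s; rw [psum_zero, psum_zero]
    | succ j ih =>
      intro hj s
      have ih := ih (by omega)
      exact le_antisymm (le_of q' hq' q hq he.symm ⟨j, hj⟩ (fun s => (ih s).symm) s)
        (le_of q hq q' hq' he ⟨j, hj⟩ ih s)
  funext s x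
  have h1 := psum_succ (q s) x
  have h2 := psum_succ (q' s) x
  have h3 := all (x + 1) x.2 s
  have h4 := all x x.2.le s
  omega

lemma isSemistandard_of_succ {q : Fin r → Fin n → ℕ}
    (hq : ∀ s s' : Fin r, s.val + 1 = s' → ∀ j, psum (q s') (j + 1) ≤ psum (q s) j) :
    IsSemistandard q := by
  rintro s ⟨s', hs'⟩ hs j
  induction s' with
  | zero => exact absurd hs (by simp [Fin.lt_def])
  | succ t ih =>
    have h1 := hq ⟨t, by omega⟩ ⟨t + 1, hs'⟩ rfl j
    rcases (Nat.lt_succ_iff_lt_or_eq.1 (show s.val < t + 1 from hs)) with h | h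
    · exact h1.trans ((psum_mono _ (Nat.le_succ j)).trans (ih (by omega) h))
    · have : s = ⟨t, by omega⟩ := Fin.ext h
      rw [this]
      exact h1

/-- The cells of level `s` of a face lie on a lattice path with at most `n + h` cells. In a face of
maximal size they fill this path, and the paths of different levels are disjoint. -/
lemma exists_subset_pathFamily (hr : 0 < r) (hm : m = h + r) {F : Finset (Fin m × Fin n)}
    (hF : IsFace r F) :
    F.card ≤ r * (n + h) ∧
      (F.card = r * (n + h) → ∃ q ∈ rectTableaux r n h, pathFamily h q = F) := by
  let q : Fin r → Fin n → ℕ := fun s y => upSteps h F s (y + 1) - upSteps h F s y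
  have hpsum : ∀ s, ∀ j ≤ n, psum (q s) j = upSteps h F s j := fun s j hj =>
    psum_eq (upSteps_zero _)
      (fun x => Nat.add_sub_cancel' (upSteps_mono s (Nat.le_succ _))) hj
  have hsum : ∀ s, ∑ y, q s y ≤ h := by
    intro s
    rw [← psum_of_le _ le_rfl, hpsum s _ le_rfl]
    exact upSteps_le _ _
  let L : Fin r → Finset (Fin m × Fin n) := fun s => F.filter fun x => level h F x.1 x.2 = s
  have hL : ∀ s, L s ⊆ pathSet h s (q s) := by
    intro s x hx
    obtain ⟨hxF, hxs⟩ := Finset.mem_filter.1 hx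
    rw [mem_pathSet, hpsum s (x.2 + 1) x.2.2, hpsum s x.2 x.2.2.le]
    have h0 := sub_le_level (h := h) (F := F) x.1 x.2
    have h1 : h + s - x.1 ≤ upSteps h F s (x.2 + 1) :=
      Finset.le_sup (f := fun x : Fin m × Fin n => h + s.val - x.1)
        (Finset.mem_filter.2 ⟨hxF, hxs, Nat.lt_succ_self _⟩)
    have h2 : upSteps h F s x.2 ≤ h + s - x.1 := by
      refine Finset.sup_le fun y hy => ?_
      obtain ⟨hyF, hys, hyx⟩ := Finset.mem_filter.1 hy
      have : ¬ y.1.val < x.1 := by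
        intro hlt
        have := level_lt (h := h) hyF hlt hyx
        omega
      omega
    omega
  have hLcard : ∀ s, (L s).card ≤ n + h := by
    intro s
    refine (Finset.card_le_card (hL s)).trans ?_
    rw [card_pathSet (by have := s.2; omega) (hsum s)]
    exact Nat.add_le_add_left (hsum s) n
  have hFL : Finset.univ.biUnion L = F := by
    ext x
    simp only [L, Finset.mem_biUnion, Finset.mem_univ, true_and, Finset.mem_filter]
    exact ⟨fun ⟨_, h, _⟩ => h, fun h => ⟨⟨_, level_lt_of_isFace hr hm hF h⟩, h, rfl⟩⟩
  have hcard : F.card = ∑ s, (L s).card := by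
    rw [← Finset.card_biUnion, hFL]
    intro s _ s' _ hs
    refine Finset.disjoint_left.2 fun x hx hx' => hs ?_
    exact Fin.ext ((Finset.mem_filter.1 hx).2.symm.trans (Finset.mem_filter.1 hx').2)
  refine ⟨?_, fun hFc => ⟨q, ?_⟩⟩
  · rw [hcard]
    refine (Finset.sum_le_sum fun s _ => hLcard s).trans ?_
    simp
  · have hEq : ∀ s, (L s).card = n + h := by
      have : ∑ s, (L s).card = ∑ s : Fin r, (n + h) := by
        rw [← hcard, hFc]
        simp
      intro s
      exact (Finset.sum_eq_sum_iff_of_le fun s _ => hLcard s).1 this s (Finset.mem_univ s)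
    have hLq : ∀ s, L s = pathSet h s (q s) := by
      intro s
      refine Finset.eq_of_subset_of_card_le (hL s) ?_
      rw [hEq, card_pathSet (by have := s.2; omega) (hsum s)]
      exact Nat.add_le_add_left (hsum s) n
    have hqs : ∀ s, ∑ y, q s y = h := by
      intro s
      have := hEq s
      rw [hLq, card_pathSet (by have := s.2; omega) (hsum s)] at this
      omega
    refine ⟨⟨isSemistandard_of_succ fun s s' hs j => ?_, hqs⟩, ?_⟩
    · rcases lt_or_ge j n with hj | hj
      · by_contra! hcon
        have hs2 := s'.2
        have b1 := psum_le (q s) j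
        have b2 := psum_le (q s') (j + 1)
        rw [hqs] at b1 b2
        have m1 := psum_mono (q s) (Nat.le_succ j)
        have m2 := psum_mono (q s') (Nat.le_succ j)
        have e1 : ((⟨h + s - psum (q s) j, by omega⟩, ⟨j, hj⟩) : Fin m × Fin n) ∈ L s := by
          rw [hLq, mem_pathSet]
          simp only [Nat.succ_eq_add_one] at *
          omega
        have e2 : ((⟨h + s' - psum (q s') (j + 1), by omega⟩, ⟨j, hj⟩) : Fin m × Fin n) ∈
            L s' := by
          rw [hLq, mem_pathSet]
          simp only [Nat.succ_eq_add_one] at *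
          omega
        -- levels weakly increase down a column, so the cell of level `s'` cannot lie weakly above
        -- the one of level `s < s'`
        have l1 := (Finset.mem_filter.1 e1).2
        have l2 := (Finset.mem_filter.1 e2).2
        simp only at l1 l2
        have := level_mono (h := h) (F := F)
          (show h + s' - psum (q s') (j + 1) ≤ h + s - psum (q s) j by omega) j
        omega
      · rw [psum_of_le _ hj, psum_of_le _ (by omega), hqs, hqs]
    · rw [pathFamily, ← hFL]
      exact Finset.biUnion_congr rfl fun s _ => (hLq s).symm

theorem ncard_maxFaces (hr : 0 < r) (hm : m = h + r) :
    (maxFaces m n r h).ncard = (rectTableaux r n h).ncard := by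
  rw [← (pathFamily_injOn (n := n) hm).ncard_image]
  congr 1
  ext F
  constructor
  · rintro ⟨hF, hc⟩
    obtain ⟨q, hq, rfl⟩ := (exists_subset_pathFamily hr hm hF).2 hc
    exact ⟨q, hq, rfl⟩
  · rintro ⟨q, hq, rfl⟩
    exact ⟨isFace_pathFamily q, card_pathFamily hm hq⟩

lemma rectTableaux_nonempty (hrn : r ≤ n) : (rectTableaux r n h).Nonempty := by
  have hps : ∀ (s : Fin r) (j : ℕ),
      psum (fun y : Fin n => if y.val = s then h else 0) j = if s.val < j then h else 0 := by
    intro s j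
    unfold psum
    have hite : ∀ y : Fin n, (if y.val = s.val then h else 0) =
        if y = s.castLE hrn then h else 0 := fun y => by simp [Fin.ext_iff]
    simp_rw [hite, Finset.sum_ite_eq']
    simp
  refine ⟨fun s y => if y.val = s then h else 0, fun s s' hs j => ?_, fun s => ?_⟩
  · rw [hps, hps]
    have : s.val < s' := hs
    split_ifs <;> omega
  · rw [← psum_of_le _ le_rfl, hps, if_pos (s.2.trans_le hrn)]

lemma ncard_maxFaces_swap {h' : ℕ} (hm : m = h + r) (hn : n = h' + r) :
    (maxFaces m n r h).ncard = (maxFaces n m r h').ncard := by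
  have hswap : ∀ {m n : ℕ} {F : Finset (Fin m × Fin n)}, IsFace r F →
      IsFace r (F.map (Equiv.prodComm _ _).toEmbedding) := by
    intro m n F hF a b
    obtain ⟨s, hs⟩ := hF b a
    refine ⟨s, fun h => hs ?_⟩
    rw [Finset.mem_map_equiv] at h
    simpa using h
  have hcard : r * (n + h) = r * (m + h') := by rw [hm, hn]; ring
  refine Set.ncard_congr (fun F _ => F.map (Equiv.prodComm _ _).toEmbedding) ?_ ?_ ?_
  · rintro F ⟨h1, h2⟩
    exact ⟨hswap h1, by rw [Finset.card_map, h2, hcard]⟩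
  · intro F G _ _ h
    exact Finset.map_injective _ h
  · rintro F ⟨h1, h2⟩
    refine ⟨F.map (Equiv.prodComm _ _).toEmbedding, ⟨hswap h1, ?_⟩, ?_⟩
    · rw [Finset.card_map, h2, hcard]
    · ext x
      simp

end paths

/-! ### Hilbert polynomials of simplicial complexes -/

section stanleyReisner
variable {ι : Type*} [Fintype ι] [DecidableEq ι]

/-- There are `C(k - 1, |F| - 1)` monomials of degree `k` whose support is exactly `F`. -/
lemma card_support_eq (F : Finset ι) {k : ℕ} (hF : 0 < F.card) (hk : F.card ≤ k) :
    {e : ι →₀ ℕ | e.degree = k ∧ e.support = F}.ncard =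
      (k - F.card + (F.card - 1)).choose (F.card - 1) := by
  have hc := Finset.card_finsuppAntidiag_nat_eq_choose (s := F) (k - F.card)
  rw [show F.card + (k - F.card) - 1 = (k - F.card) + (F.card - 1) by omega,
    Nat.choose_symm_add] at hc
  rw [← hc, ← Set.ncard_coe_finset]
  let one : ι →₀ ℕ := Finsupp.indicator F fun _ _ => 1
  have hone : ∀ i, one i = if i ∈ F then 1 else 0 := fun i => by
    simp [one, Finsupp.indicator_apply]
  have hdeg : ∀ e : ι →₀ ℕ, e.degree = ∑ i, e i := fun e => Finsupp.degree_eq_sum e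
  have hmem : ∀ e : ι →₀ ℕ, e ∈ F.finsuppAntidiag (k - F.card) ↔
      ∑ i, e i = k - F.card ∧ e.support ⊆ F := by
    intro e
    rw [Finset.mem_finsuppAntidiag]
    refine and_congr_left fun h => ?_
    rw [Finset.sum_subset (Finset.subset_univ F)]
    intro i _ hi
    exact Finsupp.notMem_support_iff.1 fun hi' => hi (h hi')
  have hsum1 : ∑ i, one i = F.card := by simp [hone]
  symm
  refine Set.ncard_congr (fun e _ => e + one) ?_ ?_ ?_
  · intro e he
    obtain ⟨h1, h2⟩ := (hmem e).1 he
    refine ⟨?_, ?_⟩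
    · rw [hdeg]
      simp only [Finsupp.add_apply, Finset.sum_add_distrib, h1, hsum1]
      omega
    · ext i
      have := @h2 i
      simp only [Finsupp.mem_support_iff, Finsupp.add_apply, hone] at this ⊢
      split_ifs with hi
      · simp [hi]
      · simpa [hi] using this
  · intro e e' _ _ h
    exact add_right_cancel h
  · rintro e ⟨h1, h2⟩
    have hle : one ≤ e := by
      intro i
      rw [hone]
      split_ifs with hi
      · rw [← h2] at hi
        exact Nat.one_le_iff_ne_zero.2 (Finsupp.mem_support_iff.1 hi)
      · exact Nat.zero_le _
    refine ⟨e - one, ?_, tsub_add_cancel_of_le hle⟩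
    rw [Finset.mem_coe, hmem]
    refine ⟨?_, ?_⟩
    · have : ∑ i, (e - one) i + ∑ i, one i = ∑ i, e i := by
        rw [← Finset.sum_add_distrib]
        exact Finset.sum_congr rfl fun i _ => by
          rw [← Finsupp.add_apply, tsub_add_cancel_of_le hle]
      rw [hsum1, ← hdeg e, h1] at this
      omega
    · rw [← h2]
      exact Finsupp.support_tsub

/-- The Hilbert function of a Stanley–Reisner ring of dimension `d` is given by a polynomial of
degree `d - 1`, and its multiplicity is the number of faces with `d` elements. -/
lemma exists_polynomial_count_monomials (Δ : Finset (Finset ι)) {d : ℕ} (hd : 0 < d)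
    (hΔ : ∀ F ∈ Δ, F.card ≤ d) (hne : ∃ F ∈ Δ, F.card = d) :
    ∃ P : Polynomial ℚ,
      (∀ᶠ k : ℕ in Filter.atTop,
        ({e : ι →₀ ℕ | e.degree = k ∧ e.support ∈ Δ}.ncard : ℚ) = P.eval (k : ℚ)) ∧
      P ≠ 0 ∧ ((Δ.filter fun F => F.card = d).card : ℚ) = P.natDegree.factorial * P.leadingCoeff := by
  let Δ' := Δ.filter fun F => 0 < F.card
  let P : Polynomial ℚ := ∑ F ∈ Δ', Polynomial.preHilbertPoly ℚ (F.card - 1) F.card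
  have hnat : P.natDegree ≤ d - 1 := by
    refine Polynomial.natDegree_sum_le_of_forall_le _ _ fun F hF => ?_
    rw [Polynomial.natDegree_preHilbertPoly]
    have := hΔ F (Finset.mem_filter.1 hF).1
    omega
  have hcoeff : P.coeff (d - 1) =
      ((Δ.filter fun F => F.card = d).card : ℚ) * ((d - 1).factorial : ℚ)⁻¹ := by
    have h1 : ∀ F ∈ Δ', (Polynomial.preHilbertPoly ℚ (F.card - 1) F.card).coeff (d - 1) =
        if F.card = d then ((d - 1).factorial : ℚ)⁻¹ else 0 := by
      intro F hF
      obtain ⟨hF, hpos⟩ := Finset.mem_filter.1 hF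
      split_ifs with h
      · rw [h]
        exact Polynomial.coeff_preHilbertPoly_self ℚ _ _
      · apply Polynomial.coeff_eq_zero_of_natDegree_lt
        rw [Polynomial.natDegree_preHilbertPoly]
        have := hΔ F hF
        omega
    rw [Polynomial.finsetSum_coeff, Finset.sum_congr rfl h1, ← Finset.sum_filter,
      Finset.sum_const, nsmul_eq_mul, Finset.filter_filter]
    congr 3
    exact Finset.filter_congr fun F _ => ⟨fun h => h.2, fun h => ⟨h ▸ hd, h⟩⟩
  have hcard : 0 < (Δ.filter fun F => F.card = d).card := by
    obtain ⟨F, hF, hFd⟩ := hne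
    exact Finset.card_pos.2 ⟨F, Finset.mem_filter.2 ⟨hF, hFd⟩⟩
  have hfac : ((d - 1).factorial : ℚ) ≠ 0 := by positivity
  have hc0 : P.coeff (d - 1) ≠ 0 := by
    rw [hcoeff]
    have : ((Δ.filter fun F => F.card = d).card : ℚ) ≠ 0 := by exact_mod_cast hcard.ne'
    exact mul_ne_zero this (inv_ne_zero hfac)
  have hdeg : P.natDegree = d - 1 := le_antisymm hnat (Polynomial.le_natDegree_of_ne_zero hc0)
  refine ⟨P, ?_, ?_, ?_⟩
  · filter_upwards [Filter.eventually_ge_atTop (max d 1)] with k hk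
    have hfin : ∀ F : Finset ι, {e : ι →₀ ℕ | e.degree = k ∧ e.support = F}.Finite := by
      intro F
      refine (Finset.finite_toSet (F.finsuppAntidiag k)).subset ?_
      rintro e ⟨h1, h2⟩
      rw [Finset.mem_coe, Finset.mem_finsuppAntidiag, ← h1, ← h2]
      exact ⟨rfl, subset_rfl⟩
    have hset : {e : ι →₀ ℕ | e.degree = k ∧ e.support ∈ Δ} =
        ↑(Δ'.biUnion fun F => (hfin F).toFinset) := by
      ext e
      simp only [Set.mem_ofPred_eq, Finset.coe_biUnion, Set.mem_iUnion, Finset.mem_coe,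
        Set.Finite.coe_toFinset, exists_prop, Δ', Finset.mem_filter]
      constructor
      · rintro ⟨h1, h2⟩
        refine ⟨e.support, ⟨h2, ?_⟩, h1, rfl⟩
        rw [Finset.card_pos, Finsupp.support_nonempty_iff]
        rintro rfl
        rw [map_zero] at h1
        omega
      · rintro ⟨F, ⟨hF, -⟩, h1, rfl⟩
        exact ⟨h1, hF⟩
    rw [hset, Set.ncard_coe_finset, Finset.card_biUnion, Polynomial.eval_finsetSum, Nat.cast_sum]
    · refine Finset.sum_congr rfl fun F hF => ?_
      obtain ⟨hF, hpos⟩ := Finset.mem_filter.1 hF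
      have hFk : F.card ≤ k := (hΔ F hF).trans (by omega)
      rw [← Set.ncard_eq_toFinset_card _ (hfin F), card_support_eq F hpos hFk,
        Polynomial.preHilbertPoly_eq_choose_sub_add ℚ _ hFk]
    · intro F _ G _ hFG
      refine Finset.disjoint_left.2 fun e he he' => hFG ?_
      rw [Set.Finite.mem_toFinset] at he he'
      exact he.2.symm.trans he'.2
  · rintro hP
    simp [hP] at hc0
  · rw [Polynomial.leadingCoeff, hdeg, hcoeff]
    field_simp

end stanleyReisner

open MvPolynomial MonomialOrder

/-! ### Leading exponents -/

section leading
variable {σ K : Type*} [Field K] (o : MonomialOrder σ)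

/-- A space of polynomials whose nonzero elements have their leading exponents in a finite set `S`
has dimension at most `|S|`: a polynomial is determined by its coefficients at `S`. -/
lemma finrank_le_of_degree_mem (V : Submodule K (MvPolynomial σ K)) (S : Finset (σ →₀ ℕ))
    (h : ∀ f ∈ V, f ≠ 0 → o.degree f ∈ S) : Module.finrank K V ≤ S.card := by
  let L : V →ₗ[K] (S → K) := (LinearMap.pi fun d : S => lcoeff K d.1) ∘ₗ V.subtype
  have hL : Function.Injective L := by
    rw [← LinearMap.ker_eq_bot, LinearMap.ker_eq_bot']
    rintro ⟨f, hf⟩ h0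
    by_contra hne
    have hf0 : f ≠ 0 := fun h => hne (Subtype.ext h)
    have := congrFun h0 ⟨_, h f hf hf0⟩
    exact o.coeff_degree_ne_zero_iff.2 hf0 this
  have := LinearMap.finrank_le_finrank_of_injective hL
  simpa using this

/-- Polynomials with distinct leading exponents are linearly independent. -/
lemma card_le_finrank_of_degree (V : Submodule K (MvPolynomial σ K)) [Module.Finite K V]
    (S : Finset (σ →₀ ℕ)) (h : ∀ d ∈ S, ∃ f ∈ V, f ≠ 0 ∧ o.degree f = d) :
    S.card ≤ Module.finrank K V := by
  classical
  choose! f hfV hf0 hfd using h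
  let v : S → V := fun d => ⟨f d.1, hfV d.1 d.2⟩
  have hv : LinearIndependent K v := by
    rw [linearIndependent_iff']
    intro s g hg
    by_contra! hcon
    obtain ⟨i, hi, hgi⟩ := hcon
    obtain ⟨d, hd, hmax⟩ := Finset.exists_max_image (s.filter fun i => g i ≠ 0)
      (fun i => o.toSyn i.1) ⟨i, Finset.mem_filter.2 ⟨hi, hgi⟩⟩
    obtain ⟨hds, hgd⟩ := Finset.mem_filter.1 hd
    have h1 : ∑ i ∈ s, g i • f i.1 = 0 := by
      simpa [v] using congrArg Subtype.val hg
    have h2 := congrArg (coeff d.1) h1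
    rw [coeff_sum, Finset.sum_eq_single d] at h2
    · rw [coeff_smul, coeff_zero, smul_eq_mul] at h2
      have h3 := o.coeff_degree_ne_zero_iff.2 (hf0 d.1 d.2)
      rw [hfd d.1 d.2] at h3
      exact mul_ne_zero hgd h3 h2
    · intro i hi hid
      rw [coeff_smul, smul_eq_mul]
      by_cases hgi : g i = 0
      · rw [hgi, zero_mul]
      · rw [o.coeff_eq_zero_of_lt, mul_zero]
        rw [hfd i.1 i.2]
        refine lt_of_le_of_ne (hmax i (Finset.mem_filter.2 ⟨hi, hgi⟩)) fun h => hid ?_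
        exact Subtype.ext (o.toSyn.injective h)
    · exact fun h => absurd hds h
  simpa using hv.fintype_card_le_finrank

lemma degree_sum_monomial {ι : Type*} (s : Finset ι) (E : ι → σ →₀ ℕ) (ε : ι → K) {i₀ : ι}
    (hi₀ : i₀ ∈ s) (hε : ε i₀ ≠ 0)
    (h : ∀ i ∈ s, i ≠ i₀ → ε i ≠ 0 → o.toSyn (E i) < o.toSyn (E i₀)) :
    ∑ i ∈ s, monomial (E i) (ε i) ≠ 0 ∧ o.degree (∑ i ∈ s, monomial (E i) (ε i)) = E i₀ := by
  classical
  have hc : coeff (E i₀) (∑ i ∈ s, monomial (E i) (ε i)) = ε i₀ := by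
    rw [coeff_sum, Finset.sum_eq_single i₀]
    · simp
    · intro i hi hne
      rw [coeff_monomial]
      split_ifs with he
      · by_contra hεi
        have := h i hi hne hεi
        rw [he] at this
        exact lt_irrefl _ this
      · rfl
    · exact fun h => absurd hi₀ h
  have hmem : E i₀ ∈ (∑ i ∈ s, monomial (E i) (ε i)).support := by
    rw [mem_support_iff, hc]
    exact hε
  refine ⟨fun h0 => hε ?_, ?_⟩
  · rw [← hc, h0, coeff_zero]
  · apply o.toSyn.injective
    refine le_antisymm (o.degree_le_iff.2 fun d hd => ?_) (o.le_degree hmem)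
    obtain ⟨i, hi, hdi⟩ := Finset.mem_biUnion.1 (support_sum hd)
    rw [mem_support_iff, coeff_monomial] at hdi
    split_ifs at hdi with he
    · rw [← he]
      rcases eq_or_ne i i₀ with rfl | hne
      · exact le_rfl
      · exact (h i hi hne hdi).le
    · exact absurd rfl hdi

end leading

lemma lex_sum_single_lt {σ : Type*} [LinearOrder σ] [WellFoundedGT σ] {t : ℕ} {x y : Fin t → σ}
    {A B : σ →₀ ℕ} (hy : StrictMono y) (s₀ : Fin t) (h1 : ∀ s < s₀, x s = y s)
    (h2 : ∀ s, s₀ ≤ s → y s₀ < x s) (hA : ∀ v ≤ y s₀, A v = 0) (hB : ∀ v ≤ y s₀, B v = 0) :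
    (lex (σ := σ)).toSyn (∑ s, Finsupp.single (x s) 1 + A) <
      lex.toSyn (∑ s, Finsupp.single (y s) 1 + B) := by
  rw [lex_lt_iff]
  refine ⟨y s₀, fun v hv => ?_, ?_⟩
  · simp only [ofLex_toLex, Finsupp.add_apply, Finsupp.finsetSum_apply, hA v hv.le, hB v hv.le]
    congr 1
    refine Finset.sum_congr rfl fun s _ => ?_
    rcases lt_or_ge s s₀ with hs | hs
    · rw [h1 s hs]
    · rw [Finsupp.single_eq_of_ne (hv.trans (h2 s hs)).ne,
        Finsupp.single_eq_of_ne (hv.trans_le (hy.monotone hs)).ne]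
  · simp only [ofLex_toLex, Finsupp.add_apply, Finsupp.finsetSum_apply, hA _ le_rfl, hB _ le_rfl]
    rw [Finset.sum_eq_zero, Nat.add_zero]
    · refine lt_of_lt_of_le ?_ (Finset.single_le_sum (fun _ _ => Nat.zero_le _)
        (Finset.mem_univ s₀))
      simp
    · intro s _
      rcases lt_or_ge s s₀ with hs | hs
      · rw [h1 s hs]
        exact Finsupp.single_eq_of_ne (hy hs).ne'
      · exact Finsupp.single_eq_of_ne (h2 s hs).ne

/-- An injective map `Fin t → Fin r` other than the inclusion exceeds the inclusion at the first
place where the two differ. -/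
lemma exists_first_lt {t r : ℕ} (h : t ≤ r) {f : Fin t → Fin r} (hf : Function.Injective f)
    (hne : f ≠ Fin.castLE h) :
    ∃ s₀, (∀ s < s₀, f s = Fin.castLE h s) ∧ Fin.castLE h s₀ < f s₀ := by
  have hex : ∃ s, f s ≠ Fin.castLE h s := by
    by_contra! hcon
    exact hne (funext hcon)
  have hfin := Set.toFinite {s | f s ≠ Fin.castLE h s}
  obtain ⟨s₀, hs₀, hmin⟩ := Set.exists_min_image _ id hfin hex
  have hlt : ∀ s < s₀, f s = Fin.castLE h s := by
    intro s hs
    by_contra hcon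
    exact not_le.2 hs (hmin s hcon)
  refine ⟨s₀, hlt, lt_of_le_of_ne (not_lt.1 fun hcon => ?_) (Ne.symm hs₀)⟩
  have h1 : (f s₀).val < s₀ := hcon
  have h2 := hlt ⟨f s₀, h1.trans s₀.2⟩ h1
  have h3 := hf (h2.trans (Fin.ext rfl : _ = f s₀))
  exact h1.ne (congrArg Fin.val h3)

/-! ### Minors of a product of two matrices -/

lemma det_mul_eq_sum {R ι : Type*} [CommRing R] [Fintype ι] {t : ℕ} (A : Matrix (Fin t) ι R)
    (B : Matrix ι (Fin t) R) :
    (A * B).det = ∑ c : Fin t → ι, (∏ s, A s (c s)) * (B.submatrix c id).det := by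
  classical
  have h : (A * B).det =
      Matrix.detRowAlternating.toMultilinearMap fun s => ∑ i, A s i • B i := by
    change Matrix.det _ = Matrix.det _
    congr 1
    ext s j
    simp [Matrix.mul_apply]
  rw [h, MultilinearMap.map_sum]
  refine Finset.sum_congr rfl fun c _ => ?_
  rw [MultilinearMap.map_smul_univ]
  rfl

lemma det_submatrix_eq_zero {R ι : Type*} [CommRing R] {t : ℕ} (B : Matrix ι (Fin t) R)
    {c : Fin t → ι} (hc : ¬ Function.Injective c) : (B.submatrix c id).det = 0 := by
  obtain ⟨i, j, hij, hne⟩ := Function.not_injective_iff.1 hc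
  exact Matrix.det_zero_of_row_eq hne (by ext k; simp [hij])

/-- The `(r + 1)`-minors of a matrix which factors through a free module of rank `r` vanish. -/
lemma det_mul_eq_zero {R : Type*} [CommRing R] {r t : ℕ} (h : r < t) (A : Matrix (Fin t) (Fin r) R)
    (B : Matrix (Fin r) (Fin t) R) : (A * B).det = 0 := by
  rw [det_mul_eq_sum]
  refine Finset.sum_eq_zero fun c _ => ?_
  rw [det_submatrix_eq_zero, mul_zero]
  intro hc
  have := Fintype.card_le_of_injective c hc
  simp at this
  omega

/-- The indices of the entries of an `m × r` matrix `Y` and of an `r × n` matrix `Z`, ordered row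
by row, with the entries of `Y` in front. -/
abbrev Vars (m r n : ℕ) : Type := (Fin m ×ₗ Fin r) ⊕ₗ (Fin r ×ₗ Fin n)

section vars
variable {m r n : ℕ}

/-- The index of an entry of `Y`. -/
def yv (i : Fin m) (s : Fin r) : Vars m r n := toLex (Sum.inl (toLex (i, s)))

/-- The index of an entry of `Z`. -/
def zv (s : Fin r) (j : Fin n) : Vars m r n := toLex (Sum.inr (toLex (s, j)))

lemma yv_lt_yv {i i' : Fin m} {s s' : Fin r} :
    (yv i s : Vars m r n) < yv i' s' ↔ i < i' ∨ i = i' ∧ s < s' := by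
  rw [yv, yv, Sum.Lex.inl_lt_inl_iff, Prod.Lex.toLex_lt_toLex]

lemma zv_lt_zv {s s' : Fin r} {j j' : Fin n} :
    (zv s j : Vars m r n) < zv s' j' ↔ s < s' ∨ s = s' ∧ j < j' := by
  rw [zv, zv, Sum.Lex.inr_lt_inr_iff, Prod.Lex.toLex_lt_toLex]

lemma yv_lt_zv (i : Fin m) (s s' : Fin r) (j : Fin n) : (yv i s : Vars m r n) < zv s' j :=
  Sum.Lex.inl_lt_inr _ _

lemma yv_inj {i i' : Fin m} {s s' : Fin r} :
    (yv i s : Vars m r n) = yv i' s' ↔ i = i' ∧ s = s' := by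
  constructor
  · intro h
    have := Sum.inl_injective (toLex.injective h)
    exact Prod.mk.inj (toLex.injective this)
  · rintro ⟨rfl, rfl⟩; rfl

lemma zv_inj {s s' : Fin r} {j j' : Fin n} :
    (zv s j : Vars m r n) = zv s' j' ↔ s = s' ∧ j = j' := by
  constructor
  · intro h
    have := Sum.inr_injective (toLex.injective h)
    exact Prod.mk.inj (toLex.injective this)
  · rintro ⟨rfl, rfl⟩; rfl

lemma vars_cases {P : Vars m r n → Prop} (hy : ∀ i s, P (yv i s)) (hz : ∀ s j, P (zv s j))
    (v : Vars m r n) : P v := by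
  induction v using Lex.rec with
  | _ v =>
    rcases v with v | v
    · exact hy (ofLex v).1 (ofLex v).2
    · exact hz (ofLex v).1 (ofLex v).2

/-- The exponent of the monomial `∏ y_{i,s} ^ p s i * ∏ z_{s,j} ^ q s j`. -/
noncomputable def expo (p : Fin r → Fin m → ℕ) (q : Fin r → Fin n → ℕ) : Vars m r n →₀ ℕ :=
  Finsupp.equivFunOnFinite.symm fun v =>
    Sum.elim (fun x : Fin m ×ₗ Fin r => p (ofLex x).2 (ofLex x).1)
      (fun x : Fin r ×ₗ Fin n => q (ofLex x).1 (ofLex x).2) (ofLex v)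

@[simp] lemma expo_yv (p : Fin r → Fin m → ℕ) (q : Fin r → Fin n → ℕ) (i : Fin m) (s : Fin r) :
    expo p q (yv i s) = p s i := rfl

@[simp] lemma expo_zv (p : Fin r → Fin m → ℕ) (q : Fin r → Fin n → ℕ) (s : Fin r) (j : Fin n) :
    expo p q (zv s j) = q s j := rfl

lemma expo_injective {p p' : Fin r → Fin m → ℕ} {q q' : Fin r → Fin n → ℕ}
    (h : expo p q = expo p' q') : p = p' ∧ q = q' :=
  ⟨funext fun s => funext fun i => by simpa using DFunLike.congr_fun h (yv i s),
    funext fun s => funext fun j => by simpa using DFunLike.congr_fun h (zv s j)⟩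

lemma expo_ext {p : Fin r → Fin m → ℕ} {q : Fin r → Fin n → ℕ} {e : Vars m r n →₀ ℕ}
    (hp : ∀ i s, e (yv i s) = p s i) (hq : ∀ s j, e (zv s j) = q s j) : e = expo p q := by
  ext v
  exact vars_cases (P := fun v => e v = expo p q v) hp hq v

lemma expo_add (p p' : Fin r → Fin m → ℕ) (q q' : Fin r → Fin n → ℕ) :
    expo (p + p') (q + q') = expo p q + expo p' q' :=
  (expo_ext (e := expo p q + expo p' q') (fun _ _ => rfl) fun _ _ => rfl).symm

variable (m r n) (K : Type*) [Field K]

/-- The generic `m × r` matrix `Y`. -/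
noncomputable def matY : Matrix (Fin m) (Fin r) (MvPolynomial (Vars m r n) K) :=
  Matrix.of fun i s => X (yv i s)

/-- The generic `r × n` matrix `Z`. -/
noncomputable def matZ : Matrix (Fin r) (Fin n) (MvPolynomial (Vars m r n) K) :=
  Matrix.of fun s j => X (zv s j)

variable {m r n}

/-- The exponent with entry `1` at the positions `(s, a s)`, for `s < t`. -/
def diagonal {t l : ℕ} (a : Fin t → Fin l) (s : Fin r) (i : Fin l) : ℕ :=
  if h : s.val < t then (if a ⟨s, h⟩ = i then 1 else 0) else 0

lemma sum_single_eq_expo {t : ℕ} (h : t ≤ r) (a : Fin t → Fin m) (b : Fin t → Fin n) :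
    ∑ s, Finsupp.single (yv (a s) (Fin.castLE h s)) 1 +
      ∑ s, Finsupp.single (zv (Fin.castLE h s) (b s)) 1 = expo (diagonal a) (diagonal b) := by
  classical
  refine expo_ext (fun i s => ?_) fun s j => ?_
  · rw [Finsupp.add_apply, Finsupp.finsetSum_apply, Finsupp.finsetSum_apply,
      Finset.sum_eq_zero (s := Finset.univ) (f := fun x : Fin t =>
        Finsupp.single (zv (Fin.castLE h x) (b x)) 1 (yv i s : Vars m r n)), Nat.add_zero]
    · simp only [Finsupp.single_apply, yv_inj, diagonal]
      split_ifs with hs ha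
      · rw [Finset.sum_eq_single ⟨s, hs⟩]
        · simp [ha]
        · intro s' _ hs'
          rw [if_neg]
          rintro ⟨-, h2⟩
          exact hs' (Fin.ext (congrArg Fin.val h2 : s'.val = s.val))
        · exact fun h => absurd (Finset.mem_univ _) h
      · refine Finset.sum_eq_zero fun s' _ => if_neg ?_
        rintro ⟨h1, h2⟩
        have : s' = ⟨s, hs⟩ := Fin.ext (congrArg Fin.val h2 : s'.val = s.val)
        exact ha (this ▸ h1)
      · refine Finset.sum_eq_zero fun s' _ => if_neg ?_
        rintro ⟨-, rfl⟩
        exact hs s'.2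
    · exact fun s' _ => Finsupp.single_eq_of_ne (yv_lt_zv _ _ _ _).ne
  · rw [Finsupp.add_apply, Finsupp.finsetSum_apply, Finsupp.finsetSum_apply,
      Finset.sum_eq_zero (s := Finset.univ) (f := fun x : Fin t =>
        Finsupp.single (yv (a x) (Fin.castLE h x)) 1 (zv s j : Vars m r n)), Nat.zero_add]
    · simp only [Finsupp.single_apply, zv_inj, diagonal]
      split_ifs with hs ha
      · rw [Finset.sum_eq_single ⟨s, hs⟩]
        · simp [ha]
        · intro s' _ hs'
          rw [if_neg]
          rintro ⟨h2, -⟩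
          exact hs' (Fin.ext (congrArg Fin.val h2 : s'.val = s.val))
        · exact fun h => absurd (Finset.mem_univ _) h
      · refine Finset.sum_eq_zero fun s' _ => if_neg ?_
        rintro ⟨h2, h1⟩
        have : s' = ⟨s, hs⟩ := Fin.ext (congrArg Fin.val h2 : s'.val = s.val)
        exact ha (this ▸ h1)
      · refine Finset.sum_eq_zero fun s' _ => if_neg ?_
        rintro ⟨rfl, -⟩
        exact hs s'.2
    · exact fun s' _ => Finsupp.single_eq_of_ne (yv_lt_zv _ _ _ _).ne'

lemma prod_X_eq_monomial {σ ι : Type*} [Fintype ι] (f : ι → σ) :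
    ∏ s, (X (f s) : MvPolynomial σ K) = monomial (∑ s, Finsupp.single (f s) 1) 1 := by
  rw [monomial_sum_one]
  rfl

lemma det_eq_sum_row {R : Type*} [CommRing R] {t : ℕ} (M : Matrix (Fin t) (Fin t) R) :
    M.det = ∑ σ : Equiv.Perm (Fin t), ((Equiv.Perm.sign σ : ℤ) : R) * ∏ s, M s (σ s) := by
  rw [← Matrix.det_transpose, Matrix.det_apply']
  rfl

lemma det_submatrix_mul {t : ℕ} (a : Fin t → Fin m) (b : Fin t → Fin n) :
    ((matY m r n K * matZ m r n K).submatrix a b).det =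
      ∑ x : (Fin t → Fin r) × Equiv.Perm (Fin t),
        monomial (∑ s, Finsupp.single (yv (a s) (x.1 s)) 1 +
          ∑ s, Finsupp.single (zv (x.1 s) (b (x.2 s))) 1)
          (if Function.Injective x.1 then ((Equiv.Perm.sign x.2 : ℤ) : K) else 0) := by
  have h : (matY m r n K * matZ m r n K).submatrix a b =
      (matY m r n K).submatrix a id * (matZ m r n K).submatrix id b := by
    ext; simp [Matrix.mul_apply]
  rw [h, det_mul_eq_sum, Fintype.sum_prod_type]
  refine Finset.sum_congr rfl fun c _ => ?_
  by_cases hc : Function.Injective c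
  · simp only [hc, if_true]
    rw [det_eq_sum_row, Finset.mul_sum]
    refine Finset.sum_congr rfl fun σ _ => ?_
    have hy : ∏ s, (matY m r n K).submatrix a id s (c s) =
        monomial (∑ s, Finsupp.single (yv (a s) (c s)) 1) 1 :=
      prod_X_eq_monomial K fun s => yv (a s) (c s)
    have hz : ∏ s, (((matZ m r n K).submatrix id b).submatrix c id) s (σ s) =
        monomial (∑ s, Finsupp.single (zv (c s) (b (σ s))) 1) 1 :=
      prod_X_eq_monomial K fun s => zv (c s) (b (σ s))
    rw [hy, hz, ← map_intCast (C : K →+* MvPolynomial (Vars m r n) K), mul_left_comm, monomial_mul,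
      C_mul_monomial, one_mul, mul_one]
  · rw [det_submatrix_eq_zero _ hc, mul_zero]
    simp [hc]

/-- The leading monomial of the minor `[a | b]` of `Y * Z` is
`∏ y_{a s, s} * ∏ z_{s, b s}`. -/
theorem degree_det_submatrix_mul {t : ℕ} (h : t ≤ r) (a : Fin t ↪o Fin m) (b : Fin t ↪o Fin n) :
    ((matY m r n K * matZ m r n K).submatrix a b).det ≠ 0 ∧
      lex.degree ((matY m r n K * matZ m r n K).submatrix a b).det =
        expo (diagonal a) (diagonal b) := by
  rw [det_submatrix_mul, ← sum_single_eq_expo h]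
  refine degree_sum_monomial lex Finset.univ (fun x : (Fin t → Fin r) × Equiv.Perm (Fin t) =>
        ∑ s, Finsupp.single (yv (a s) (x.1 s)) 1 + ∑ s, Finsupp.single (zv (x.1 s) (b (x.2 s))) 1)
    (fun x => if Function.Injective x.1 then ((Equiv.Perm.sign x.2 : ℤ) : K) else 0)
    (i₀ := (Fin.castLE h, 1)) (Finset.mem_univ _) ?_ ?_
  · simp [Fin.castLE_injective h]
  · rintro ⟨c, σ⟩ - hne hε
    have hc : Function.Injective c := by
      by_contra hc
      simp [hc] at hε
    by_cases hcc : c = Fin.castLE h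
    · subst hcc
      have hσ : (σ : Fin t → Fin t) ≠ Fin.castLE le_rfl := by
        intro hσ
        refine hne (Prod.ext rfl (Equiv.ext fun s => ?_))
        simpa using congrFun hσ s
      obtain ⟨s₀, h1, h2⟩ := exists_first_lt le_rfl σ.injective hσ
      simp only [Fin.castLE_rfl, id_eq] at h1 h2
      rw [add_comm, add_comm (∑ s, Finsupp.single (yv (a s) (Fin.castLE h s)) 1)]
      -- both monomials have the same part in the entries of `Y`, so only `Z` is compared
      rw [map_add, map_add]
      refine add_lt_add_left ?_ _
      have := lex_sum_single_lt (x := fun s => (zv (Fin.castLE h s) (b (σ s)) : Vars m r n))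
        (y := fun s => zv (Fin.castLE h s) (b s)) (A := 0) (B := 0)
        (fun s s' hs => zv_lt_zv.2 (Or.inl hs)) s₀ (fun s hs => by rw [h1 s hs]) ?_
        (fun _ _ => rfl) fun _ _ => rfl
      · simpa using this
      · intro s hs
        rw [zv_lt_zv]
        rcases hs.eq_or_lt with rfl | hs
        · exact Or.inr ⟨rfl, b.strictMono h2⟩
        · exact Or.inl hs
    · obtain ⟨s₀, h1, h2⟩ := exists_first_lt h hc hcc
      refine lex_sum_single_lt (x := fun s => (yv (a s) (c s) : Vars m r n))
        (y := fun s => yv (a s) (Fin.castLE h s))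
        (fun s s' hs => yv_lt_yv.2 (Or.inl (a.strictMono hs))) s₀ (fun s hs => by rw [h1 s hs]) ?_
        ?_ ?_
      · intro s hs
        rw [yv_lt_yv]
        rcases hs.eq_or_lt with rfl | hs
        · exact Or.inr ⟨rfl, h2⟩
        · exact Or.inl (a.strictMono hs)
      · intro v hv
        rw [Finsupp.finsetSum_apply]
        exact Finset.sum_eq_zero fun s _ =>
          Finsupp.single_eq_of_ne (hv.trans_lt (yv_lt_zv _ _ _ _)).ne
      · intro v hv
        rw [Finsupp.finsetSum_apply]
        exact Finset.sum_eq_zero fun s _ =>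
          Finsupp.single_eq_of_ne (hv.trans_lt (yv_lt_zv _ _ _ _)).ne

/-- The leading monomial of `det Y`, for a square matrix `Y`, is the diagonal one. -/
theorem degree_det_matY :
    (matY r r n K).det ≠ 0 ∧
      lex.degree (matY r r n K).det = expo (diagonal (id : Fin r → Fin r)) 0 := by
  have h0 : expo (diagonal (id : Fin r → Fin r)) (0 : Fin r → Fin n → ℕ) =
      ∑ s, Finsupp.single (yv s s) 1 := by
    refine (expo_ext (fun i s => ?_) fun s j => ?_).symm
    · rw [Finsupp.finsetSum_apply]
      rw [Finset.sum_eq_single s]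
      · simp [Finsupp.single_apply, yv_inj, diagonal, eq_comm]
      · intro s' _ hs'
        exact Finsupp.single_eq_of_ne fun h => hs' (yv_inj.1 h).2.symm
      · exact fun h => absurd (Finset.mem_univ _) h
    · rw [Finsupp.finsetSum_apply]
      exact Finset.sum_eq_zero fun s' _ => Finsupp.single_eq_of_ne (yv_lt_zv _ _ _ _).ne'
  have h1 : (matY r r n K).det = ∑ σ : Equiv.Perm (Fin r),
      monomial (∑ s, Finsupp.single (yv s (σ s)) 1) ((Equiv.Perm.sign σ : ℤ) : K) := by
    rw [det_eq_sum_row]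
    refine Finset.sum_congr rfl fun σ _ => ?_
    have hy : ∏ s, matY r r n K s (σ s) =
        monomial (∑ s, Finsupp.single (yv s (σ s)) 1) 1 :=
      prod_X_eq_monomial K fun s => yv s (σ s)
    rw [hy, ← map_intCast (C : K →+* MvPolynomial (Vars r r n) K), C_mul_monomial, mul_one]
  rw [h1, h0]
  refine degree_sum_monomial lex Finset.univ
    (fun σ : Equiv.Perm (Fin r) => ∑ s, Finsupp.single (yv s (σ s) : Vars r r n) 1)
    (fun σ => ((Equiv.Perm.sign σ : ℤ) : K)) (i₀ := 1) (Finset.mem_univ _) (by simp) ?_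
  intro σ _ hne _
  have hσ : (σ : Fin r → Fin r) ≠ Fin.castLE le_rfl := by
    intro hσ
    refine hne (Equiv.ext fun s => ?_)
    simpa using congrFun hσ s
  obtain ⟨s₀, h1, h2⟩ := exists_first_lt le_rfl σ.injective hσ
  simp only [Fin.castLE_rfl, id_eq] at h1 h2
  have := lex_sum_single_lt (x := fun s => (yv s (σ s) : Vars r r n))
    (y := fun s => yv s s) (A := 0) (B := 0)
    (fun s s' hs => yv_lt_yv.2 (Or.inl hs)) s₀ (fun s hs => by rw [h1 s hs]) ?_
    (fun _ _ => rfl) fun _ _ => rfl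
  · simpa using this
  · intro s hs
    rw [yv_lt_yv]
    rcases hs.eq_or_lt with rfl | hs
    · exact Or.inr ⟨rfl, h2⟩
    · exact Or.inl hs

end vars

/-! ### Pairs of tableaux as leading exponents -/

section peel
variable {r m n : ℕ}

lemma psum_diagonal {t : ℕ} (b : Fin t → Fin n) (s : Fin r) (j : ℕ) :
    psum (diagonal b s) j = if h : s.val < t then (if (b ⟨s, h⟩).val < j then 1 else 0) else 0 := by
  unfold psum diagonal
  by_cases h : s.val < t
  · simp only [h, dif_pos]
    rw [Finset.sum_ite_eq]
    simp
  · simp [h]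

lemma sum_diagonal {t : ℕ} (b : Fin t → Fin n) (s : Fin r) :
    ∑ j, diagonal b s j = if s.val < t then 1 else 0 := by
  unfold diagonal
  split_ifs with h
  · rw [Finset.sum_ite_eq]
    simp
  · simp

/-- Removing the first column of a tableau. -/
lemma IsSemistandard.exists_add_diagonal {c : Fin r → Fin n → ℕ} (hc : IsSemistandard c) {t : ℕ}
    (htr : t ≤ r) (ht : ∀ s : Fin r, s.val < t ↔ 0 < ∑ j, c s j) :
    ∃ (b : Fin t ↪o Fin n) (c' : Fin r → Fin n → ℕ), IsSemistandard c' ∧ c = c' + diagonal b := by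
  have hex : ∀ s : Fin t, ∃ j, 0 < c (Fin.castLE htr s) j ∧
      ∀ j' < j, c (Fin.castLE htr s) j' = 0 := by
    intro s
    have hpos := (ht (Fin.castLE htr s)).1 s.2
    have hne : {j | 0 < c (Fin.castLE htr s) j}.Nonempty := by
      obtain ⟨j, -, hj⟩ := Finset.exists_ne_zero_of_sum_ne_zero hpos.ne'
      exact ⟨j, Nat.pos_of_ne_zero hj⟩
    obtain ⟨j, hj, hmin⟩ := Set.exists_min_image _ id (Set.toFinite _) hne
    refine ⟨j, hj, fun j' hj' => ?_⟩
    by_contra hcon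
    exact not_le.2 hj' (hmin j' (Nat.pos_of_ne_zero hcon))
  choose b hb hmin using hex
  have hps0 : ∀ (s : Fin t) (j : ℕ), j ≤ b s → psum (c (Fin.castLE htr s)) j = 0 := by
    intro s j hj
    refine Finset.sum_eq_zero fun x hx => hmin s x ?_
    rw [Fin.lt_def]
    exact (Finset.mem_filter.1 hx).2.trans_le hj
  have hb_mono : StrictMono b := by
    intro s s' hs
    by_contra! hcon
    have h1 := hc (Fin.castLE htr s) (Fin.castLE htr s') hs (b s')
    rw [hps0 s _ hcon, psum_succ] at h1
    have := hb s'
    omega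
  have hle : diagonal b ≤ c := by
    intro s j
    unfold diagonal
    split_ifs with h1 h2
    · rw [← h2]
      exact hb ⟨s, h1⟩
    · exact Nat.zero_le _
    · exact Nat.zero_le _
  have hcadd : c = c - diagonal b + diagonal b := (tsub_add_cancel_of_le hle).symm
  refine ⟨OrderEmbedding.ofStrictMono b hb_mono, c - diagonal b, ?_, hcadd⟩
  intro s s' hs j
  have h1 : ∀ s j, psum (c s) j = psum ((c - diagonal b : Fin r → Fin n → ℕ) s) j + psum (diagonal b s) j := by
    intro s j
    rw [← psum_add]
    exact congrArg (fun f => psum (f s) j) hcadd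
  have h2 := hc s s' hs j
  have e1 := h1 s j
  have e2 := h1 s' (j + 1)
  rw [psum_diagonal] at e1 e2
  rcases lt_or_ge s'.val t with hs' | hs'
  · have hst : s.val < t := (show s.val < s' from hs).trans hs'
    rw [dif_pos hst] at e1
    rw [dif_pos hs'] at e2
    rcases le_or_gt (j + 1) (b ⟨s', hs'⟩).val with hj | hj
    · have := hps0 ⟨s', hs'⟩ _ hj
      simp only [Fin.castLE_mk, Fin.eta] at this
      omega
    · rw [if_pos hj] at e2
      split_ifs at e1 <;> omega
  · have h3 : ∑ j, c s' j = 0 := by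
      by_contra hcon
      exact not_lt.2 hs' ((ht s').2 (Nat.pos_of_ne_zero hcon))
    have := psum_le (c s') (j + 1)
    omega

/-- The number of nonzero rows of a tableau. -/
lemma IsSemistandard.exists_length {c : Fin r → Fin n → ℕ} (hc : IsSemistandard c) :
    ∃ t ≤ r, ∀ s : Fin r, s.val < t ↔ 0 < ∑ j, c s j := by
  have hex : ∃ t, ∀ s : Fin r, 0 < ∑ j, c s j → s.val < t := ⟨r, fun s _ => s.2⟩
  classical
  refine ⟨Nat.find hex, Nat.find_min' hex fun s _ => s.2, fun s => ⟨fun hs => ?_,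
    Nat.find_spec hex s⟩⟩
  have := Nat.find_min hex hs
  push Not at this
  obtain ⟨s', h1, h2⟩ := this
  exact h1.trans_le (hc.sum_le h2)

end peel

/-- The pairs of semistandard tableaux of the same shape, with `k` boxes and at most `r` rows and
with entries in `Fin m` and `Fin n` respectively. -/
def tableauPairs (r m n k : ℕ) : Set ((Fin r → Fin m → ℕ) × (Fin r → Fin n → ℕ)) :=
  {x | IsSemistandard x.1 ∧ IsSemistandard x.2 ∧ (∀ s, ∑ i, x.1 s i = ∑ j, x.2 s j) ∧
    ∑ s, ∑ i, x.1 s i = k}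

lemma finite_tableauPairs (r m n k : ℕ) : (tableauPairs r m n k).Finite := by
  refine ((Set.finite_Iic (fun _ _ => k : Fin r → Fin m → ℕ)).prod
    (Set.finite_Iic (fun _ _ => k : Fin r → Fin n → ℕ))).subset ?_
  rintro ⟨p, q⟩ ⟨-, -, h1, h2⟩
  have hp : ∀ s, ∑ i, p s i ≤ k := fun s => by
    rw [← h2]
    exact Finset.single_le_sum (f := fun s => ∑ i, p s i) (fun _ _ => Nat.zero_le _)
      (Finset.mem_univ s)
  refine ⟨fun s i => ?_, fun s j => ?_⟩
  · exact (Finset.single_le_sum (f := fun i => p s i) (fun _ _ => Nat.zero_le _)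
      (Finset.mem_univ i)).trans (hp s)
  · refine le_trans ?_ ((h1 s).symm.le.trans (hp s))
    exact Finset.single_le_sum (f := fun j => q s j) (fun _ _ => Nat.zero_le _) (Finset.mem_univ j)

section product
variable {m n r : ℕ} (K : Type*) [Field K]

lemma aeval_det_submatrix {S : Type*} [CommRing S] [Algebra K S] (M : Matrix (Fin m) (Fin n) S)
    {t : ℕ} (a : Fin t → Fin m) (b : Fin t → Fin n) :
    aeval (fun x : Fin m × Fin n => M x.1 x.2)
      ((Matrix.mvPolynomialX (Fin m) (Fin n) K).submatrix a b).det = (M.submatrix a b).det := by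
  rw [AlgHom.map_det]
  congr 1
  ext i j
  simp [Matrix.mvPolynomialX]

lemma isHomogeneous_det_submatrix {t : ℕ} (a : Fin t → Fin m) (b : Fin t → Fin n) :
    ((Matrix.mvPolynomialX (Fin m) (Fin n) K).submatrix a b).det.IsHomogeneous t := by
  rw [det_eq_sum_row]
  refine IsHomogeneous.sum _ _ _ fun σ _ => ?_
  have h1 := isHomogeneous_C (Fin m × Fin n) ((Equiv.Perm.sign σ : ℤ) : K)
  have h2 : (∏ s, (Matrix.mvPolynomialX (Fin m) (Fin n) K).submatrix a b s (σ s)).IsHomogeneous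
      (∑ s : Fin t, 1) :=
    IsHomogeneous.prod _ _ _ fun s _ => isHomogeneous_X _ _
  have := h1.mul h2
  simpa using this

variable (m n r)

/-- The substitution `X ↦ Y * Z`. -/
noncomputable def prodMap : MvPolynomial (Fin m × Fin n) K →ₐ[K] MvPolynomial (Vars m r n) K :=
  aeval fun x => (matY m r n K * matZ m r n K) x.1 x.2

variable {m n r}

/-- Every pair of tableaux of the same shape is a leading exponent: multiply the minors of `Y * Z`
given by the pairs of columns with the same index. -/
lemma exists_degree_prodMap {p : Fin r → Fin m → ℕ} {q : Fin r → Fin n → ℕ} {k : ℕ}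
    (h : (p, q) ∈ tableauPairs r m n k) :
    ∃ g : MvPolynomial (Fin m × Fin n) K, g.IsHomogeneous k ∧ prodMap m n r K g ≠ 0 ∧
      lex.degree (prodMap m n r K g) = expo p q := by
  induction k using Nat.strong_induction_on generalizing p q with
  | _ k ih =>
    obtain ⟨hp, hq, hpq, hk⟩ := h
    simp only at hp hq hpq hk
    obtain ⟨t, htr, ht⟩ := hp.exists_length
    have ht' : ∀ s : Fin r, s.val < t ↔ 0 < ∑ j, q s j := fun s => by rw [ht, hpq]
    obtain ⟨a, p', hp', hpa⟩ := hp.exists_add_diagonal htr ht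
    obtain ⟨b, q', hq', hqb⟩ := hq.exists_add_diagonal htr ht'
    have hpsum : ∀ s, ∑ i, p s i = ∑ i, p' s i + if s.val < t then 1 else 0 := fun s => by
      rw [← sum_diagonal a s, ← Finset.sum_add_distrib, hpa]
      rfl
    have hqsum : ∀ s, ∑ j, q s j = ∑ j, q' s j + if s.val < t then 1 else 0 := fun s => by
      rw [← sum_diagonal b s, ← Finset.sum_add_distrib, hqb]
      rfl
    have hcount : ∑ s : Fin r, (if s.val < t then 1 else 0) = t := by
      rw [Fin.sum_univ_eq_sum_range (fun s => if s < t then 1 else 0), ← Finset.sum_filter]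
      rw [Finset.sum_const, smul_eq_mul, mul_one]
      have : (Finset.range r).filter (fun s => s < t) = Finset.range t := by
        ext s
        simp only [Finset.mem_filter, Finset.mem_range]
        omega
      rw [this, Finset.card_range]
    have hk' : k = ∑ s, ∑ i, p' s i + t := by
      rw [← hk, ← hcount, ← Finset.sum_add_distrib]
      exact Finset.sum_congr rfl fun s _ => hpsum s
    rcases Nat.eq_zero_or_pos t with h0 | hpos
    · subst h0
      have hp0 : p = 0 := by
        funext s i
        have := (ht s).not.1 (Nat.not_lt_zero _)
        exact (Finset.sum_eq_zero_iff.1 (Nat.eq_zero_of_not_pos this)) i (Finset.mem_univ i)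
      have hq0 : q = 0 := by
        funext s j
        have := (ht' s).not.1 (Nat.not_lt_zero _)
        exact (Finset.sum_eq_zero_iff.1 (Nat.eq_zero_of_not_pos this)) j (Finset.mem_univ j)
      have hk0 : k = 0 := by rw [← hk, hp0]; simp
      refine ⟨1, hk0 ▸ isHomogeneous_one _ _, by simp, ?_⟩
      rw [map_one, degree_one, hp0, hq0]
      exact expo_ext (fun _ _ => rfl) fun _ _ => rfl
    · obtain ⟨g, hg, hg0, hgd⟩ := ih (∑ s, ∑ i, p' s i) (by omega)
        (p := p') (q := q') ⟨hp', hq', fun s => by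
          have h1 := hpsum s
          have h2 := hqsum s
          have h3 := hpq s
          simp only
          omega, rfl⟩
      obtain ⟨hd0, hdd⟩ := degree_det_submatrix_mul K htr a b
      have hdet : prodMap m n r K
          ((Matrix.mvPolynomialX (Fin m) (Fin n) K).submatrix a b).det =
            ((matY m r n K * matZ m r n K).submatrix a b).det := aeval_det_submatrix K _ _ _
      refine ⟨g * ((Matrix.mvPolynomialX (Fin m) (Fin n) K).submatrix a b).det, ?_, ?_, ?_⟩
      · rw [hk']
        exact hg.mul (isHomogeneous_det_submatrix K a b)
      · rw [map_mul, hdet]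
        exact mul_ne_zero hg0 hd0
      · rw [map_mul, hdet, degree_mul hg0 hd0, hgd, hdd, hpa, hqb, expo_add]

end product

/-! ### Monomials without long diagonals span the determinantal ring -/

section spanning
variable {m n : ℕ} (K : Type*) [Field K]

/-- The exponents of degree `k` whose support contains no diagonal of length `r + 1`. -/
def faceExponents (m n r k : ℕ) : Set (Fin m × Fin n →₀ ℕ) :=
  {e | e.degree = k ∧ IsFace r e.support}

lemma finite_faceExponents (m n r k : ℕ) : (faceExponents m n r k).Finite := by
  refine (Finset.finite_toSet ((Finset.univ : Finset (Fin m × Fin n)).finsuppAntidiag k)).subset ?_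
  rintro e ⟨h1, -⟩
  rw [Finset.mem_coe, Finset.mem_finsuppAntidiag, ← h1, Finsupp.degree_eq_sum]
  exact ⟨rfl, Finset.subset_univ _⟩

/-- The weights `i * j` of the indeterminates single out the diagonal of each minor as the term of
largest weight, by the rearrangement inequality. -/
lemma sum_perm_mul_lt {t : ℕ} (a : Fin t ↪o Fin m) (b : Fin t ↪o Fin n) {σ : Equiv.Perm (Fin t)}
    (hσ : σ ≠ 1) : ∑ s, (a (σ s)).val * (b s).val < ∑ s, (a s).val * (b s).val := by
  have ha : StrictMono fun s => (a s).val := a.strictMono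
  have hb : StrictMono fun s => (b s).val := b.strictMono
  have hab : Monovary (fun s => (a s).val) fun s => (b s).val :=
    ha.monotone.monovary hb.monotone
  rw [hab.sum_comp_perm_mul_lt_sum_mul_iff]
  intro h
  refine hσ ?_
  have hmono : Monotone σ := by
    intro s s' hs
    rcases hs.eq_or_lt with rfl | hs
    · exact le_rfl
    · exact ha.le_iff_le.1 (h (hb hs))
  have hstrict : StrictMono σ := hmono.strictMono_of_injective σ.injective
  have : (hstrict.orderIsoOfSurjective _ σ.surjective) = OrderIso.refl _ := Subsingleton.elim _ _
  ext s
  exact congrArg Fin.val (DFunLike.congr_fun this s)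

lemma mk_monomial_mem_span {r k : ℕ} (e : Fin m × Fin n →₀ ℕ) (he : e.degree = k) :
    Ideal.Quotient.mk (detIdeal K m n (r + 1)) (monomial e 1) ∈
      Submodule.span K ((fun e => Ideal.Quotient.mk (detIdeal K m n (r + 1)) (monomial e 1)) ''
        faceExponents m n r k) := by
  induction hw : Finsupp.weight (fun x : Fin m × Fin n => x.1.val * x.2.val) e
    using Nat.strong_induction_on generalizing e with
  | _ w ih =>
    by_cases hface : IsFace r e.support
    · exact Submodule.subset_span ⟨e, ⟨he, hface⟩, rfl⟩
    · unfold IsFace at hface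
      push Not at hface
      obtain ⟨a, b, hab⟩ := hface
      let D : Equiv.Perm (Fin (r + 1)) → (Fin m × Fin n →₀ ℕ) :=
        fun σ => ∑ s, Finsupp.single (a (σ s), b s) 1
      have hD1 : D 1 ≤ e := by
        classical
        intro x
        simp only [D, Finsupp.finsetSum_apply, Equiv.Perm.coe_one, id_eq]
        by_cases hx : ∃ s, (a s, b s) = x
        · obtain ⟨s, rfl⟩ := hx
          rw [Finset.sum_eq_single s]
          · rw [Finsupp.single_eq_same]
            exact Nat.pos_of_ne_zero (Finsupp.mem_support_iff.1 (hab s))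
          · intro s' _ hs'
            refine Finsupp.single_eq_of_ne fun h => hs' ?_
            exact (a.injective (Prod.mk.inj h).1).symm
          · exact fun h => absurd (Finset.mem_univ _) h
        · rw [Finset.sum_eq_zero]
          · exact Nat.zero_le _
          · intro s _
            exact Finsupp.single_eq_of_ne fun h => hx ⟨s, h.symm⟩
      have hdet : ∑ σ : Equiv.Perm (Fin (r + 1)), ((Equiv.Perm.sign σ : ℤ) : K) •
          Ideal.Quotient.mk (detIdeal K m n (r + 1)) (monomial (e - D 1 + D σ) 1) = 0 := by
        have h1 : Ideal.Quotient.mk (detIdeal K m n (r + 1)) (monomial (e - D 1) 1 *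
            ((Matrix.mvPolynomialX (Fin m) (Fin n) K).submatrix a b).det) = 0 :=
          Ideal.Quotient.eq_zero_iff_mem.2 (Ideal.mul_mem_left _ _
            (Ideal.subset_span ⟨a, b, rfl⟩))
        rw [← h1, Matrix.det_apply', Finset.mul_sum, map_sum]
        refine Finset.sum_congr rfl fun σ _ => ?_
        have h2 : ∏ s, (Matrix.mvPolynomialX (Fin m) (Fin n) K).submatrix a b (σ s) s =
            monomial (D σ) 1 := prod_X_eq_monomial K fun s => (a (σ s), b s)
        rw [h2, mul_left_comm, monomial_mul, one_mul, ← map_intCast (C : K →+* _), ← smul_eq_C_mul]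
        rfl
      have hdeg : ∀ σ, (D σ).degree = r + 1 := fun σ => by
        simp [D, map_sum]
      have hweight : ∀ σ, Finsupp.weight (fun x : Fin m × Fin n => x.1.val * x.2.val) (D σ) =
          ∑ s, (a (σ s)).val * (b s).val := fun σ => by
        simp [D, map_sum, Finsupp.weight_single]
      have he1 : e - D 1 + D 1 = e := tsub_add_cancel_of_le hD1
      rw [← Finset.add_sum_erase _ _ (Finset.mem_univ (1 : Equiv.Perm (Fin (r + 1)))), he1] at hdet
      simp only [Equiv.Perm.sign_one, Units.val_one, Int.cast_one, one_smul] at hdet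
      rw [eq_neg_of_add_eq_zero_left hdet]
      refine Submodule.neg_mem _ (Submodule.sum_mem _ fun σ hσ => Submodule.smul_mem _ _ ?_)
      have h3 := congrArg Finsupp.degree he1
      have h4 := congrArg (Finsupp.weight fun x : Fin m × Fin n => x.1.val * x.2.val) he1
      rw [map_add] at h3 h4
      have h5 := sum_perm_mul_lt a b (Finset.ne_of_mem_erase hσ)
      have h6 := hweight 1
      simp only [Equiv.Perm.coe_one, id_eq] at h6
      refine ih _ ?_ (e - D 1 + D σ) ?_ rfl
      · rw [map_add, hweight, ← hw, ← h4, h6]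
        omega
      · rw [map_add, hdeg, ← he, ← h3, hdeg]

lemma detRingGrading_le_span (r k : ℕ) : detRingGrading K m n r k ≤
    Submodule.span K ((fun e => Ideal.Quotient.mk (detIdeal K m n (r + 1)) (monomial e 1)) ''
      faceExponents m n r k) := by
  rintro _ ⟨f, hf, rfl⟩
  rw [SetLike.mem_coe, mem_homogeneousSubmodule] at hf
  rw [AlgHom.toLinearMap_apply, f.as_sum, map_sum]
  refine Submodule.sum_mem _ fun e he => ?_
  have h1 : monomial e (coeff e f) = coeff e f • (monomial e 1 : MvPolynomial (Fin m × Fin n) K) := by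
    rw [smul_monomial, smul_eq_mul, mul_one]
  rw [h1, map_smul]
  refine Submodule.smul_mem _ _ (mk_monomial_mem_span K e ?_)
  have := hf (mem_support_iff.1 he)
  rw [Finsupp.degree_eq_weight_one]
  exact this

lemma finite_detRingGrading (r k : ℕ) : Module.Finite K (detRingGrading K m n r k) := by
  have := FiniteDimensional.span_of_finite K ((finite_faceExponents m n r k).image
    fun e => Ideal.Quotient.mk (detIdeal K m n (r + 1)) (monomial e 1))
  exact Submodule.finiteDimensional_of_le (detRingGrading_le_span K r k)

lemma finrank_detRingGrading_le (r k : ℕ) :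
    Module.finrank K (detRingGrading K m n r k) ≤ (faceExponents m n r k).ncard := by
  have hfin := (finite_faceExponents m n r k).image
    fun e => Ideal.Quotient.mk (detIdeal K m n (r + 1)) (monomial e (1 : K))
  have := FiniteDimensional.span_of_finite K hfin
  refine (Submodule.finrank_mono (detRingGrading_le_span K r k)).trans ?_
  have := hfin.fintype
  refine (finrank_span_le_card _).trans ?_
  rw [← Set.ncard_eq_toFinset_card']
  exact Set.ncard_image_le (finite_faceExponents m n r k)

end spanning

/-! ### The Hilbert function of the determinantal ring -/

section hilbert
variable {m n r : ℕ} (K : Type*) [Field K]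

/-- A factorization `A * B` through a free module of rank `r` defines a homomorphism on the
determinantal ring. -/
noncomputable def detRingLift {S : Type*} [CommRing S] [Algebra K S] (A : Matrix (Fin m) (Fin r) S)
    (B : Matrix (Fin r) (Fin n) S) : DetRing K m n r →ₐ[K] S :=
  Ideal.Quotient.liftₐ (detIdeal K m n (r + 1)) (aeval fun x => (A * B) x.1 x.2) <| by
    have : detIdeal K m n (r + 1) ≤
        RingHom.ker (aeval (R := K) fun x : Fin m × Fin n => (A * B) x.1 x.2) := by
      refine Ideal.span_le.2 ?_
      rintro _ ⟨a, b, rfl⟩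
      rw [SetLike.mem_coe, RingHom.mem_ker, aeval_det_submatrix K (A * B)]
      have h : (A * B).submatrix a b = A.submatrix a id * B.submatrix id b := by
        ext; simp [Matrix.mul_apply]
      rw [h, det_mul_eq_zero (Nat.lt_succ_self r)]
    exact fun f hf => this hf

lemma detRingLift_mk {S : Type*} [CommRing S] [Algebra K S] (A : Matrix (Fin m) (Fin r) S)
    (B : Matrix (Fin r) (Fin n) S) (f : MvPolynomial (Fin m × Fin n) K) :
    detRingLift K A B (Ideal.Quotient.mk _ f) = aeval (fun x => (A * B) x.1 x.2) f := rfl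

/-- The Burge correspondence embeds the monomials without long diagonals into the pairs of
tableaux. -/
lemma ncard_faceExponents_le (hr : 0 < r) (k : ℕ) :
    (faceExponents m n r k).ncard ≤ (tableauPairs r m n k).ncard := by
  have hchain : ∀ e ∈ faceExponents m n r k,
      ¬ HasChain (fun i j => extendZero e i j ≠ 0) (r + 1) m n := fun e he =>
    not_hasChain_extendZero he.2 fun x hx => Finsupp.mem_support_iff.2 hx
  refine Set.ncard_le_ncard_of_injOn (fun e => (burgeLeft r e, burgeRight r e)) ?_ ?_
    (finite_tableauPairs r m n k)
  · intro e he
    refine ⟨isSemistandard_burgeLeft _, isSemistandard_burgeRight _, fun s => ?_, ?_⟩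
    · simp only
      rw [sum_burgeLeft, sum_burgeRight]
    · rw [sum_sum_burgeLeft hr (hchain e he), ← he.1, Finsupp.degree_eq_sum]
  · intro e he e' he' h
    obtain ⟨h1, h2⟩ := Prod.mk.inj h
    exact DFunLike.coe_injective
      (burge_correspondence_injective hr (hchain e he) (hchain e' he') h1 h2)

/-- The image of the degree `k` part of the determinantal ring under `X ↦ Y * Z`. -/
noncomputable def prodImage (m n r k : ℕ) : Submodule K (MvPolynomial (Vars m r n) K) :=
  (detRingGrading K m n r k).map (detRingLift K (matY m r n K) (matZ m r n K)).toLinearMap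

lemma mem_prodImage {k : ℕ} {f : MvPolynomial (Vars m r n) K} :
    f ∈ prodImage K m n r k ↔ ∃ g : MvPolynomial (Fin m × Fin n) K,
      g.IsHomogeneous k ∧ prodMap m n r K g = f := by
  constructor
  · rintro ⟨_, ⟨g, hg, rfl⟩, rfl⟩
    exact ⟨g, hg, rfl⟩
  · rintro ⟨g, hg, rfl⟩
    exact ⟨_, ⟨g, hg, rfl⟩, rfl⟩

open Classical in
lemma card_image_tableauPairs (k : ℕ) :
    ((finite_tableauPairs r m n k).toFinset.image fun x => expo x.1 x.2).card =
      (tableauPairs r m n k).ncard := by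
  rw [Finset.card_image_of_injective, ← Set.ncard_eq_toFinset_card _ (finite_tableauPairs r m n k)]
  intro x y h
  exact Prod.ext (expo_injective h).1 (expo_injective h).2

/-- The chain of inequalities `#faceExponents ≤ #tableauPairs ≤ dim prodImage ≤ dim (R_{r+1})_k ≤
#faceExponents` forces equality throughout. -/
theorem finrank_detRingGrading (hr : 0 < r) (k : ℕ) :
    Module.finrank K (detRingGrading K m n r k) = (faceExponents m n r k).ncard ∧
      Module.finrank K (prodImage K m n r k) = (tableauPairs r m n k).ncard := by
  classical
  have := finite_detRingGrading K (m := m) (n := n) r k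
  have hfin : Module.Finite K (prodImage K m n r k) := by unfold prodImage; infer_instance
  have h1 := finrank_detRingGrading_le K (m := m) (n := n) r k
  have h2 : Module.finrank K (prodImage K m n r k) ≤
      Module.finrank K (detRingGrading K m n r k) := Submodule.finrank_map_le _ _
  have h3 := card_le_finrank_of_degree lex (prodImage K m n r k)
    ((finite_tableauPairs r m n k).toFinset.image fun x => expo x.1 x.2) (by
      intro d hd
      obtain ⟨⟨p, q⟩, hx, rfl⟩ := Finset.mem_image.1 hd
      obtain ⟨g, hg, hg0, hgd⟩ := exists_degree_prodMap K ((Set.Finite.mem_toFinset _).1 hx)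
      exact ⟨_, (mem_prodImage K).2 ⟨g, hg, rfl⟩, hg0, hgd⟩)
  rw [card_image_tableauPairs] at h3
  have h4 := ncard_faceExponents_le (m := m) (n := n) hr k
  omega

/-- The leading exponents in the image of `X ↦ Y * Z` are exactly those given by pairs of tableaux
of the same shape, since these already account for the whole dimension. -/
theorem exists_tableauPair_of_degree (hr : 0 < r) {k : ℕ} {g : MvPolynomial (Fin m × Fin n) K}
    (hg : g.IsHomogeneous k) (hg0 : prodMap m n r K g ≠ 0) :
    ∃ x ∈ tableauPairs r m n k, lex.degree (prodMap m n r K g) = expo x.1 x.2 := by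
  classical
  by_contra! hcon
  have := finite_detRingGrading K (m := m) (n := n) r k
  have hfin : Module.Finite K (prodImage K m n r k) := by unfold prodImage; infer_instance
  have h3 := card_le_finrank_of_degree lex (prodImage K m n r k)
    (insert (lex.degree (prodMap m n r K g))
      ((finite_tableauPairs r m n k).toFinset.image fun x => expo x.1 x.2)) (by
      intro d hd
      rcases Finset.mem_insert.1 hd with rfl | hd
      · exact ⟨_, (mem_prodImage K).2 ⟨g, hg, rfl⟩, hg0, rfl⟩
      obtain ⟨⟨p, q⟩, hx, rfl⟩ := Finset.mem_image.1 hd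
      obtain ⟨g, hg, hg0, hgd⟩ := exists_degree_prodMap K ((Set.Finite.mem_toFinset _).1 hx)
      exact ⟨_, (mem_prodImage K).2 ⟨g, hg, rfl⟩, hg0, hgd⟩)
  rw [Finset.card_insert_of_notMem, card_image_tableauPairs,
    (finrank_detRingGrading K hr k).2] at h3
  · omega
  · intro hmem
    obtain ⟨x, hx, he⟩ := Finset.mem_image.1 hmem
    exact hcon x ((Set.Finite.mem_toFinset _).1 hx) he.symm

end hilbert

/-! ### Powers of the ideal of maximal minors -/

section maximalMinors
variable {r n : ℕ} (K : Type*) [Field K]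

/-- The space spanned by the products of `k` maximal minors of the generic `r × n` matrix. -/
noncomputable def minorProducts (r n k : ℕ) : Submodule K (MvPolynomial (Fin r × Fin n) K) :=
  Submodule.span K (minors (Matrix.mvPolynomialX (Fin r) (Fin n) K) r) ^ k

lemma finite_minors {A : Type*} [CommRing A] {m n : ℕ} (M : Matrix (Fin m) (Fin n) A) (t : ℕ) :
    (minors M t).Finite := by
  have h : minors M t ⊆ Set.range fun x : (Fin t → Fin m) × (Fin t → Fin n) =>
      (M.submatrix x.1 x.2).det := by
    rintro _ ⟨a, b, rfl⟩
    exact ⟨(a, b), rfl⟩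
  exact (Set.finite_range _).subset h

lemma finite_minorProducts (k : ℕ) : Module.Finite K (minorProducts K r n k) :=
  Module.Finite.iff_fg.2 ((Submodule.fg_span (finite_minors _ _)).pow k)

lemma minorProducts_le_homogeneousSubmodule (k : ℕ) :
    minorProducts K r n k ≤ homogeneousSubmodule (Fin r × Fin n) K (k * r) := by
  induction k with
  | zero =>
    rw [minorProducts, pow_zero, zero_mul, Submodule.one_le]
    exact isHomogeneous_one _ _
  | succ k ih =>
    rw [minorProducts, pow_succ, add_mul, one_mul]
    refine (mul_le_mul' ih (Submodule.span_le.2 ?_)).trans (homogeneousSubmodule_mul _ _)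
    rintro _ ⟨a, b, rfl⟩
    exact isHomogeneous_det_submatrix K a b

/-- The substitution `X ↦ Z`. -/
noncomputable def toZ (m r n : ℕ) :
    MvPolynomial (Fin r × Fin n) K →ₐ[K] MvPolynomial (Vars m r n) K :=
  aeval fun x => matZ m r n K x.1 x.2

lemma prodMap_injective : Function.Injective (prodMap r n r K) := by
  let θ : MvPolynomial (Vars r r n) K →ₐ[K] MvPolynomial (Fin r × Fin n) K :=
    aeval fun v => Sum.elim (fun x : Fin r ×ₗ Fin r => if (ofLex x).1 = (ofLex x).2 then 1 else 0)
      (fun x : Fin r ×ₗ Fin n => X (ofLex x)) (ofLex v)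
  have hy : ∀ i s, θ (X (yv i s)) = if i = s then 1 else 0 := fun i s => by
    simp [θ, yv]
    congr
  have hz : ∀ s j, θ (X (zv s j)) = X (s, j) := fun s j => by
    simp [θ, zv]
  have h : θ.comp (prodMap r n r K) = AlgHom.id K _ := by
    ext1 ⟨i, j⟩
    simp [prodMap, Matrix.mul_apply, matY, matZ, hy, hz]
  exact Function.LeftInverse.injective (g := θ) fun f => DFunLike.congr_fun h f

lemma coe_orderEmbedding_fin (a : Fin r ↪o Fin r) : (a : Fin r → Fin r) = id := by
  have hsurj := Finite.surjective_of_injective a.injective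
  have : a.strictMono.orderIsoOfSurjective _ hsurj = OrderIso.refl _ := Subsingleton.elim _ _
  funext s
  exact DFunLike.congr_fun this s

lemma prodMap_minor {a : Fin r ↪o Fin r} {b : Fin r ↪o Fin n} :
    prodMap r n r K ((Matrix.mvPolynomialX (Fin r) (Fin n) K).submatrix a b).det =
      (matY r r n K).det *
        toZ K r r n ((Matrix.mvPolynomialX (Fin r) (Fin n) K).submatrix a b).det := by
  have h1 : prodMap r n r K ((Matrix.mvPolynomialX (Fin r) (Fin n) K).submatrix a b).det =
      ((matY r r n K * matZ r r n K).submatrix a b).det := aeval_det_submatrix K _ _ _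
  have h2 : toZ K r r n ((Matrix.mvPolynomialX (Fin r) (Fin n) K).submatrix a b).det =
      ((matZ r r n K).submatrix a b).det := aeval_det_submatrix K _ _ _
  rw [h1, h2, ← Matrix.det_mul, coe_orderEmbedding_fin a]
  congr 1

/-- On products of `k` maximal minors, substituting `Y * Z` for `X` amounts to multiplication by
`det Y ^ k`. -/
lemma prodMap_eq_of_mem {k : ℕ} {f : MvPolynomial (Fin r × Fin n) K}
    (hf : f ∈ minorProducts K r n k) :
    prodMap r n r K f = (matY r r n K).det ^ k * toZ K r r n f := by
  induction k generalizing f with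
  | zero =>
    rw [minorProducts, pow_zero] at hf
    obtain ⟨c, rfl⟩ := Submodule.mem_one.1 hf
    simp
  | succ k ih =>
    rw [minorProducts, pow_succ] at hf
    induction hf using Submodule.mul_induction_on' with
    | mem_mul_mem g hg h hh =>
      have h1 : prodMap r n r K h = (matY r r n K).det * toZ K r r n h := by
        induction hh using Submodule.span_induction with
        | mem x hx =>
          obtain ⟨a, b, rfl⟩ := hx
          exact prodMap_minor K
        | zero => simp
        | add x y _ _ hx hy => rw [map_add, map_add, hx, hy, mul_add]
        | smul c x _ hx => rw [map_smul, map_smul, hx, mul_smul_comm]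
      rw [map_mul, map_mul, ih hg, h1]
      ring
    | add x _ y _ hx hy => rw [map_add, map_add, hx, hy, mul_add]

lemma nsmul_expo {m : ℕ} (k : ℕ) (p : Fin r → Fin m → ℕ) (q : Fin r → Fin n → ℕ) :
    k • expo p q = expo (k • p) (k • q) :=
  expo_ext (fun _ _ => rfl) fun _ _ => rfl

/-- Every rectangular tableau occurs: its columns give the maximal minors to be multiplied. -/
lemma exists_degree_minorProducts {k : ℕ} {q : Fin r → Fin n → ℕ} (hq : q ∈ rectTableaux r n k) :
    ∃ g ∈ minorProducts K r n k, prodMap r n r K g ≠ 0 ∧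
      lex.degree (prodMap r n r K g) = expo (k • diagonal (id : Fin r → Fin r)) q := by
  induction k generalizing q with
  | zero =>
    refine ⟨1, by rw [minorProducts, pow_zero]; exact Submodule.one_le.1 le_rfl, by simp, ?_⟩
    have hq0 : q = 0 := by
      funext s j
      exact (Finset.sum_eq_zero_iff.1 (hq.2 s)) j (Finset.mem_univ j)
    rw [map_one, degree_one, hq0, zero_smul]
    exact expo_ext (fun _ _ => rfl) fun _ _ => rfl
  | succ k ih =>
    obtain ⟨b, q', hq', hqb⟩ := hq.1.exists_add_diagonal le_rfl fun s =>
      ⟨fun _ => by rw [hq.2]; omega, fun _ => s.2⟩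
    have hq'2 : ∀ s, ∑ j, q' s j = k := by
      intro s
      have h1 := hq.2 s
      have h2 := sum_diagonal b s
      rw [if_pos s.2] at h2
      rw [hqb] at h1
      simp only [Pi.add_apply, Finset.sum_add_distrib] at h1
      omega
    obtain ⟨g, hg, hg0, hgd⟩ := ih ⟨hq', hq'2⟩
    obtain ⟨hd0, hdd⟩ := degree_det_submatrix_mul K le_rfl (RelEmbedding.refl _ : Fin r ↪o Fin r) b
    have hdet : prodMap r n r K ((Matrix.mvPolynomialX (Fin r) (Fin n) K).submatrix
        (RelEmbedding.refl _ : Fin r ↪o Fin r) b).det =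
          ((matY r r n K * matZ r r n K).submatrix (RelEmbedding.refl _ : Fin r ↪o Fin r) b).det :=
      aeval_det_submatrix K _ _ _
    refine ⟨g * ((Matrix.mvPolynomialX (Fin r) (Fin n) K).submatrix
      (RelEmbedding.refl _ : Fin r ↪o Fin r) b).det, ?_, ?_, ?_⟩
    · rw [minorProducts, pow_succ]
      exact Submodule.mul_mem_mul hg (Submodule.subset_span ⟨_, b, rfl⟩)
    · rw [map_mul, hdet]
      exact mul_ne_zero hg0 hd0
    · rw [map_mul, hdet, degree_mul hg0 hd0, hgd, hdd, ← expo_add, ← hqb, succ_nsmul]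
      rfl

/-- The leading exponent of `prodMap f`, for `f` a combination of products of `k` maximal minors,
comes from a pair of tableaux of the same shape; as `det Y ^ k` divides `prodMap f`, this shape is a
rectangle. -/
lemma exists_rectTableau_of_degree (hr : 0 < r) {k : ℕ} {f : MvPolynomial (Fin r × Fin n) K}
    (hf : f ∈ minorProducts K r n k) (hf0 : prodMap r n r K f ≠ 0) :
    ∃ q ∈ rectTableaux r n k,
      lex.degree (prodMap r n r K f) = expo (k • diagonal (id : Fin r → Fin r)) q := by
  obtain ⟨⟨p, q⟩, ⟨-, hq, hpq, hk⟩, hd⟩ := exists_tableauPair_of_degree K hr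
    (minorProducts_le_homogeneousSubmodule K k hf) hf0
  simp only at hq hpq hk hd
  obtain ⟨hY0, hYd⟩ := degree_det_matY (r := r) (n := n) K
  have hmul := prodMap_eq_of_mem K hf
  have hf0' := hf0
  rw [hmul] at hf0'
  have hle : ∀ s i, (k • diagonal (id : Fin r → Fin r)) s i ≤ p s i := by
    intro s i
    have h1 := hd
    rw [hmul, degree_mul (left_ne_zero_of_mul hf0') (right_ne_zero_of_mul hf0'), degree_pow, hYd,
      nsmul_expo] at h1
    have h2 := DFunLike.congr_fun h1 (yv i s)
    rw [Finsupp.add_apply, expo_yv, expo_yv] at h2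
    omega
  have hdiag : ∀ s : Fin r, ∑ i, (k • diagonal (id : Fin r → Fin r)) s i = k := by
    intro s
    have := sum_diagonal (id : Fin r → Fin r) s
    rw [if_pos s.2] at this
    simp only [Pi.smul_apply, smul_eq_mul]
    rw [← Finset.mul_sum, this, mul_one]
  have hrow : ∀ s ∈ Finset.univ, ∑ i, (k • diagonal (id : Fin r → Fin r)) s i = ∑ i, p s i := by
    refine (Finset.sum_eq_sum_iff_of_le fun s _ => Finset.sum_le_sum fun i _ => hle s i).1 ?_
    rw [hk, Finset.sum_congr rfl fun s _ => hdiag s]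
    simp [mul_comm]
  have hp : p = k • diagonal (id : Fin r → Fin r) := by
    funext s i
    exact ((Finset.sum_eq_sum_iff_of_le fun i _ => hle s i).1
      (hrow s (Finset.mem_univ s)) i (Finset.mem_univ i)).symm
  refine ⟨q, ⟨hq, fun s => ?_⟩, ?_⟩
  · rw [← hpq, hp, hdiag]
  · rw [hd, hp]

theorem finrank_minorProducts (hr : 0 < r) (k : ℕ) :
    Module.finrank K (minorProducts K r n k) = (rectTableaux r n k).ncard := by
  classical
  have hfin : (rectTableaux r n k).Finite := by
    refine (Set.finite_Iic (fun _ _ => k : Fin r → Fin n → ℕ)).subset fun q hq s j => ?_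
    rw [← hq.2 s]
    exact Finset.single_le_sum (f := fun j => q s j) (fun _ _ => Nat.zero_le _) (Finset.mem_univ j)
  have := finite_minorProducts K (r := r) (n := n) k
  let V := (minorProducts K r n k).map (prodMap r n r K).toLinearMap
  have hV : Module.finrank K V = Module.finrank K (minorProducts K r n k) :=
    (Submodule.equivMapOfInjective _ (prodMap_injective K) _).finrank_eq.symm
  let S := hfin.toFinset.image fun q => expo (k • diagonal (id : Fin r → Fin r)) q
  have hS : S.card = (rectTableaux r n k).ncard := by
    rw [Finset.card_image_of_injective _ fun q q' h => (expo_injective h).2,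
      ← Set.ncard_eq_toFinset_card _ hfin]
  rw [← hV, ← hS]
  refine le_antisymm (finrank_le_of_degree_mem lex V S ?_) (card_le_finrank_of_degree lex V S ?_)
  · rintro _ ⟨f, hf, rfl⟩ hf0
    obtain ⟨q, hq, hd⟩ := exists_rectTableau_of_degree K hr hf hf0
    exact Finset.mem_image.2 ⟨q, hfin.mem_toFinset.2 hq, hd.symm⟩
  · intro d hd
    obtain ⟨q, hq, rfl⟩ := Finset.mem_image.1 hd
    obtain ⟨g, hg, hg0, hgd⟩ := exists_degree_minorProducts K (hfin.mem_toFinset.1 hq)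
    exact ⟨_, ⟨g, hg, rfl⟩, hg0, hgd⟩

end maximalMinors

/-! ### Minimal numbers of generators -/

section generators
variable {σ K : Type*} [Field K]

/-- In an ideal generated in degree `D`, only the constant term of a factor contributes to the
component of degree `D`. -/
lemma homogeneousComponent_mul_of_mem_span {D : ℕ} {V : Submodule K (MvPolynomial σ K)}
    (hV : V ≤ homogeneousSubmodule σ K D) {f : MvPolynomial σ K}
    (hf : f ∈ Ideal.span (V : Set (MvPolynomial σ K))) (c : MvPolynomial σ K) :
    homogeneousComponent D (c * f) = coeff 0 c • homogeneousComponent D f := by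
  induction hf using Submodule.span_induction generalizing c with
  | mem v hv =>
    have h1 : ∀ i, homogeneousComponent D (homogeneousComponent i c * v) =
        if D = i + D then homogeneousComponent i c * v else 0 := fun i =>
      homogeneousComponent_of_mem
        ((homogeneousComponent_isHomogeneous i c).mul (hV hv))
    have h2 : homogeneousComponent D v = v := by
      rw [homogeneousComponent_of_mem (hV hv), if_pos rfl]
    conv_lhs => rw [← sum_homogeneousComponent c, Finset.sum_mul, map_sum]
    rw [Finset.sum_eq_single 0]
    · rw [h1, if_pos (by omega), homogeneousComponent_zero, h2, smul_eq_C_mul]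
    · intro i _ hi
      rw [h1, if_neg (by omega)]
    · intro h
      simp at h
  | zero => simp
  | add x y _ _ hx hy => rw [mul_add, map_add, map_add, hx, hy, smul_add]
  | smul a x _ hx =>
    rw [smul_eq_mul, ← mul_assoc, hx, hx, ← constantCoeff_eq, map_mul, mul_smul]

/-- An ideal generated by a space `V` of forms of the same degree is minimally generated by
`dim V` elements. -/
theorem spanFinrank_span_eq_finrank {D : ℕ} {V : Submodule K (MvPolynomial σ K)}
    (hV : V ≤ homogeneousSubmodule σ K D) [Module.Finite K V] :
    (Ideal.span (V : Set (MvPolynomial σ K))).spanFinrank = Module.finrank K V := by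
  have hfg : V.FG := Module.Finite.iff_fg.1 ‹_›
  obtain ⟨T, hTc, hT⟩ := hfg.exists_span_finset_card_eq_spanFinrank
  have hTV : T.card = Module.finrank K V := by
    rw [hTc, ← Submodule.spanFinrank_top, ← Module.finrank_eq_spanFinrank_of_free]
  have hspan : Ideal.span (V : Set (MvPolynomial σ K)) = Ideal.span (T : Set _) := by
    rw [← hT]
    exact Submodule.span_span_of_tower K (MvPolynomial σ K) (T : Set (MvPolynomial σ K))
  refine le_antisymm ?_ ?_
  · rw [hspan, ← hTV, ← Set.ncard_coe_finset]
    exact Submodule.spanFinrank_span_le_ncard_of_finite T.finite_toSet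
  · have hfgI : (Ideal.span (V : Set (MvPolynomial σ K))).FG := by
      rw [hspan]
      exact Submodule.fg_span T.finite_toSet
    obtain ⟨s, hsc, hs⟩ := Submodule.FG.exists_span_finset_card_eq_spanFinrank hfgI
    classical
    rw [← hsc]
    have hle : V ≤ Submodule.span K ((s.image (homogeneousComponent D) : Finset _) : Set _) := by
      intro v hv
      have hvs : v ∈ Submodule.span (MvPolynomial σ K) (s : Set (MvPolynomial σ K)) := by
        rw [hs]
        exact Ideal.subset_span hv
      have hcomp : ∀ f ∈ Submodule.span (MvPolynomial σ K) (s : Set (MvPolynomial σ K)),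
          homogeneousComponent D f ∈
            Submodule.span K ((s.image (homogeneousComponent D) : Finset _) : Set _) := by
        intro f hf
        induction hf using Submodule.span_induction with
        | mem x hx => exact Submodule.subset_span (Finset.mem_image_of_mem _ hx)
        | zero => rw [map_zero]; exact Submodule.zero_mem _
        | add x y _ _ hx hy => rw [map_add]; exact Submodule.add_mem _ hx hy
        | smul c x hx' hx =>
          rw [hs] at hx'
          rw [smul_eq_mul, homogeneousComponent_mul_of_mem_span hV hx']
          exact Submodule.smul_mem _ _ hx
      have := hcomp v hvs
      rwa [homogeneousComponent_of_mem (hV hv), if_pos rfl] at this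
    exact (Submodule.finrank_mono hle).trans
      ((finrank_span_finset_le_card _).trans Finset.card_image_le)

end generators

section powers
variable {r n : ℕ} (K : Type*) [Field K]

lemma spanFinrank_span_minors_pow (hr : 0 < r) (k : ℕ) :
    (Ideal.span (minors (Matrix.mvPolynomialX (Fin r) (Fin n) K) r) ^ k).spanFinrank =
      (rectTableaux r n k).ncard := by
  have := finite_minorProducts K (r := r) (n := n) k
  rw [← finrank_minorProducts K hr,
    ← spanFinrank_span_eq_finrank (minorProducts_le_homogeneousSubmodule K k)]
  congr 1
  rw [minorProducts, Submodule.span_pow, Submodule.span_pow]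
  exact (Submodule.span_span_of_tower K _ _).symm

lemma map_span_minors {A B : Type*} [CommRing A] [CommRing B] (f : A →+* B) {m n : ℕ}
    (M : Matrix (Fin m) (Fin n) A) (t : ℕ) :
    (Ideal.span (minors M t)).map f = Ideal.span (minors (M.map f) t) := by
  rw [Ideal.map_span]
  congr 1
  have hdet : ∀ (a : Fin t ↪o Fin m) (b : Fin t ↪o Fin n),
      f (M.submatrix a b).det = ((M.map f).submatrix a b).det := fun a b => by
    rw [RingHom.map_det]
    rfl
  ext d
  constructor
  · rintro ⟨_, ⟨a, b, rfl⟩, rfl⟩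
    exact ⟨a, b, hdet a b⟩
  · rintro ⟨a, b, rfl⟩
    exact ⟨_, ⟨a, b, rfl⟩, hdet a b⟩

/-- If the `r × n` matrix `M` over `A` can be specialized to the generic matrix, the powers of the
ideal of its maximal minors need as many generators as in the generic case. -/
lemma spanFinrank_span_minors_pow_of_retraction {A : Type*} [CommRing A] [Algebra K A]
    (M : Matrix (Fin r) (Fin n) A) (ψ : A →ₐ[K] MvPolynomial (Fin r × Fin n) K)
    (hψ : ∀ s j, ψ (M s j) = X (s, j)) (hr : 0 < r) (k : ℕ) :
    (Ideal.span (minors M r) ^ k).spanFinrank = (rectTableaux r n k).ncard := by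
  have h1 : (Ideal.span (minors (Matrix.mvPolynomialX (Fin r) (Fin n) K) r) ^ k).map
      (aeval (R := K) fun x : Fin r × Fin n => M x.1 x.2).toRingHom =
        Ideal.span (minors M r) ^ k := by
    rw [Ideal.map_pow, map_span_minors]
    congr 3
    ext s j
    simp [Matrix.mvPolynomialX]
  have h2 : (Ideal.span (minors M r) ^ k).map ψ.toRingHom =
      Ideal.span (minors (Matrix.mvPolynomialX (Fin r) (Fin n) K) r) ^ k := by
    rw [Ideal.map_pow, map_span_minors]
    congr 3
    ext1 s j
    exact hψ s j
  rw [← spanFinrank_span_minors_pow K hr k]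
  refine le_antisymm ?_ ?_
  · rw [← h1]
    exact Ideal.spanFinrank_map_le_of_fg _
      (Ideal.FG.pow (Submodule.fg_span (finite_minors _ _)))
  · rw [← h2]
    exact Ideal.spanFinrank_map_le_of_fg _
      (Ideal.FG.pow (Submodule.fg_span (finite_minors _ _)))

lemma minors_transpose {A : Type*} [CommRing A] {m n : ℕ} (M : Matrix (Fin m) (Fin n) A) (t : ℕ) :
    minors M.transpose t = minors M t := by
  have h : ∀ {m n : ℕ} (M : Matrix (Fin m) (Fin n) A), minors M t ⊆ minors M.transpose t := by
    rintro m n M _ ⟨a, b, rfl⟩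
    exact ⟨b, a, by rw [← Matrix.det_transpose]; rfl⟩
  exact (h M.transpose).antisymm (h M)

variable {m : ℕ}

lemma spanFinrank_rowIdeal_pow (hr : 0 < r) (h : r ≤ m) (k : ℕ) :
    (rowIdeal K m n r h ^ k).spanFinrank = (rectTableaux r n k).ncard := by
  refine spanFinrank_span_minors_pow_of_retraction K _
    (detRingLift K (Matrix.of fun i s => if i = Fin.castLE h s then 1 else 0)
      (Matrix.mvPolynomialX (Fin r) (Fin n) K)) (fun s j => ?_) hr k
  simp only [genericMatrix, Matrix.submatrix_apply, Matrix.map_apply, detRingLift_mk]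
  simp [Matrix.mvPolynomialX, Matrix.mul_apply]

lemma spanFinrank_colIdeal_pow (hr : 0 < r) (h : r ≤ n) (k : ℕ) :
    (colIdeal K m n r h ^ k).spanFinrank = (rectTableaux r m k).ncard := by
  rw [colIdeal, ← minors_transpose]
  refine spanFinrank_span_minors_pow_of_retraction K _
    (detRingLift K (Matrix.mvPolynomialX (Fin r) (Fin m) K).transpose
      (Matrix.of fun s j => if j = Fin.castLE h s then 1 else 0)) (fun s j => ?_) hr k
  simp only [genericMatrix, Matrix.transpose_apply, Matrix.submatrix_apply, Matrix.map_apply,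
    detRingLift_mk]
  simp [Matrix.mvPolynomialX, Matrix.mul_apply]

/-- The multiplicity of the determinantal ring is the number of faces of maximal size. -/
lemma hasMultiplicity_detRing {h : ℕ} (hr : 0 < r) (hrn : r ≤ n) (hm : m = h + r) :
    HasMultiplicity (detRingGrading K m n r) (maxFaces m n r h).ncard := by
  classical
  let Δ : Finset (Finset (Fin m × Fin n)) := Finset.univ.filter fun F => IsFace r F
  have hmem : ∀ F, F ∈ Δ ↔ IsFace r F := fun F => by simp [Δ]
  have hmax : (maxFaces m n r h).ncard =
      (Δ.filter fun F => F.card = r * (n + h)).card := by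
    rw [← Set.ncard_coe_finset]
    congr 1
    ext F
    simp [maxFaces, Δ]
  obtain ⟨q, hq⟩ := rectTableaux_nonempty (h := h) hrn
  obtain ⟨P, hP, hP0, hlead⟩ := exists_polynomial_count_monomials Δ
    (d := r * (n + h)) (Nat.mul_pos hr (by omega))
    (fun F hF => (exists_subset_pathFamily hr hm ((hmem F).1 hF)).1)
    ⟨pathFamily h q, (hmem _).2 (isFace_pathFamily q), card_pathFamily hm hq⟩
  refine ⟨P, ?_, Or.inl ⟨hP0, ?_⟩⟩
  · filter_upwards [hP] with k hk
    rw [(finrank_detRingGrading K hr k).1, ← hk]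
    congr 2
    ext e
    simp [faceExponents, hmem]
  · rw [hmax, hlead]

end powers
end Determinantal

theorem lemma4p2 (K : Type*) [Field K] (m n r : ℕ) (hr : 1 ≤ r) (hm : r < m) (hn : r < n) :
    ∃ e : ℕ, Determinantal.HasMultiplicity (Determinantal.detRingGrading K m n r) e ∧
      e = (Determinantal.rowIdeal K m n r hm.le ^ (m - r)).spanFinrank ∧
      e = (Determinantal.colIdeal K m n r hn.le ^ (n - r)).spanFinrank := by
  have hm' : m = m - r + r := by omega
  have hn' : n = n - r + r := by omega
  refine ⟨(Determinantal.maxFaces m n r (m - r)).ncard,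
    Determinantal.hasMultiplicity_detRing K hr hn.le hm', ?_, ?_⟩
  · rw [Determinantal.spanFinrank_rowIdeal_pow K hr, Determinantal.ncard_maxFaces hr hm']
  · rw [Determinantal.spanFinrank_colIdeal_pow K hr, Determinantal.ncard_maxFaces_swap hm' hn',
      Determinantal.ncard_maxFaces hr hn']
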